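/- **Definitions.** A *near-edge* $A=A_1A_2\dots A_k$ ($k\ge 1$) consists of $k$ points of the plane, no three collinear, with strictly increasing $x$-coordinates. An *edge* of a point set is a segment joining two of its points, and a *triangulation* is a maximal set of edges that do not intersect except at common end points. A near-edge is a *chain* if every segment $A_iA_{i+1}$ belongs to every triangulation of $\{A_1,\dots,A_k\}$. Two near-edges have the same *order type* if they have the same number of points and corresponding triples of points have the same orientation. Let $A=A_1\dots A_k$ and $B=B_1\dots B_l$ be near-edges with $k,l\ge 2$. Put $D=(0,0)$, $F=(2,0)$, and $E=(1,-1)$ for the *convex sum* $A\vee B$, respectively $E=(1,1)$ for the *concave sum* $A\wedge B$. The sum is a near-edge $\sigma(A_1)\dots\sigma(A_k)\,\tau(B_2)\dots\tau(B_l)$, where $\sigma,\tau$ are orientation-preserving affine maps with $\sigma(A_1)=D$, $\sigma(A_k)=E=\tau(B_1)$, $\tau(B_l)=F$, such that for each of the two pieces $\sigma(A)$, $\tau(B)$ the orthogonal projections of its points to the line through its end points are strictly ordered in the direction from its first to its last point, and multiplying the distances of the points of that piece to this line by any common factor $\varepsilon\in(0,1]$ changes the orientation of no triple of points of the whole sum.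 The sum is determined up to order type. A single point is, by convention, neutral for both operations. An *upper triangulation* of a chain $C=C_1\dots C_k$ with $i$ segments consists of a monotone polyline $U$ (the roof) with $i$ segments, from $C_1$ to $C_k$ through some of the points of $C$, lying nowhere below the polyline $C_1C_2\dots C_k$, together with a maximal set of non-intersecting edges of $C$ among those that lie between $C_1C_2\dots C_k$ and $U$. Define $$t_C(y)=\sum_{i\ge 0}\#\{\text{upper triangulations of } C \text{ with } i \text{ segments}\}\,y^i\in\mathbb Q[y]$$ (the term $i=0$ occurs only for a single point, for which $t_C=1$), and $m_C=\mathcal M(t_C)\in\mathbb Q[x]$, where $\mathcal M\colon\mathbb Q[y]\to\mathbb Q[x]$ is the linear map with $$\mathcal M(y^n)=\sum_{k=0}^{\lfloor n/2\rfloor}(-1)^k\binom{n-k}{k}x^{n-k}\qquad(n\ge 0).$$ **Proposition.** Let $\mathcal C$ be the set of all (non-empty) chains, considered up to order type. Any two chains have a concave sum and a convex sum, all such sums are chains, and their order types depend only on those of the summands; $(\mathcal C,\wedge)$ and $(\mathcal C,\vee)$ are monoids whose neutral element is the one-point chain. The polynomials $t_C$ and $m_C$ depend only on the order type of $C$, and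 * $C\mapsto t_C$ is a homomorphism of monoids from $(\mathcal C,\wedge)$ to $(\mathbb Q[y],\cdot)$; * $C\mapsto m_C$ is a homomorphism of monoids from $(\mathcal C,\vee)$ to $(\mathbb Q[x],\cdot)$. -/

import Mathlib

open Polynomial

/-- The points `a`, `b`, `c` of the plane are in counterclockwise order. -/
def Ccw (a b c : ℝ × ℝ) : Prop :=
  0 < (b.1 - a.1) * (c.2 - a.2) - (b.2 - a.2) * (c.1 - a.1)

/-- Two families of points have the same order type. All ordered triples are compared, so that
both "counterclockwise" and "clockwise" are preserved. -/
def SameOrderType {ι : Type*} (f g : ι → ℝ × ℝ) : Prop :=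
  ∀ i j k : ι, Ccw (f i) (f j) (f k) ↔ Ccw (g i) (g j) (g k)

/-- The scalar product of the plane. -/
def dot (u v : ℝ × ℝ) : ℝ := u.1 * v.1 + u.2 * v.2

/-- The orthogonal projection of `p` onto the line through `a` and `b` (where `a ≠ b`). -/
noncomputable def foot (a b p : ℝ × ℝ) : ℝ × ℝ :=
  a + (dot (p - a) (b - a) / dot (b - a) (b - a)) • (b - a)

/-- Shrinking `p` by the factor `ε` towards the line through `a` and `b`. -/
noncomputable def shrink (ε : ℝ) (a b p : ℝ × ℝ) : ℝ × ℝ :=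
  foot a b p + ε • (p - foot a b p)

/-- The polyline `a 0, …, a k` is a near-edge of the point set `{a 0, …, a k} ∪ {b j}`: in the
rotated coordinate system with origin `a 0` whose first axis points to `a k`, the points `a i` have
strictly increasing first coordinates, and shrinking the polyline towards the line through `a 0` and
`a k` does not change the order type of the point set. -/
def IsNearEdgeOf {k : ℕ} {ι : Type*} (a : Fin (k + 1) → ℝ × ℝ) (b : ι → ℝ × ℝ) : Prop :=
  0 < k ∧
  StrictMono (fun i => dot (a i - a 0) (a (Fin.last k) - a 0)) ∧
  ∀ ε : ℝ, 0 < ε → ε ≤ 1 →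
    SameOrderType (Sum.elim a b)
      (Sum.elim (fun i => shrink ε (a 0) (a (Fin.last k)) (a i)) b)

/-- A (standalone) near-edge with `n` segments: `n + 1` points in general position, listed by
strictly increasing `x`-coordinate. -/
structure NearEdge where
  n : ℕ
  pt : Fin (n + 1) → ℝ × ℝ
  strictMono_fst : StrictMono (fun i => (pt i).1)
  general : ∀ i j k : Fin (n + 1), i < j → j < k → ¬ Collinear ℝ {pt i, pt j, pt k}

namespace NearEdge

/-- The edges of the point set, as pairs of indices in increasing order. -/
def edges (C : NearEdge) : Set (Fin (C.n + 1) × Fin (C.n + 1)) := {e | e.1 < e.2}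

/-- No two different edges in `T` intersect, except possibly at common end points. -/
def NonCrossing (C : NearEdge) (T : Set (Fin (C.n + 1) × Fin (C.n + 1))) : Prop :=
  T.Pairwise fun e f =>
    Disjoint (openSegment ℝ (C.pt e.1) (C.pt e.2)) (openSegment ℝ (C.pt f.1) (C.pt f.2))

/-- A triangulation of the point set: a maximal set of non-intersecting edges. -/
def IsTriangulation (C : NearEdge) (T : Set (Fin (C.n + 1) × Fin (C.n + 1))) : Prop :=
  Maximal (fun S => S ⊆ C.edges ∧ C.NonCrossing S) T

/-- The point set is a chain: the segments joining consecutive points belong to every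
triangulation. -/
def IsChain (C : NearEdge) : Prop :=
  ∀ T, C.IsTriangulation T → ∀ i : Fin C.n, (i.castSucc, i.succ) ∈ T

/-- The monotone polyline through the points whose indices are in `R`. -/
def polyline (C : NearEdge) (R : Set (Fin (C.n + 1))) : Set (ℝ × ℝ) :=
  {p | ∃ i ∈ R, ∃ j ∈ R, i < j ∧ (∀ k ∈ R, ¬ (i < k ∧ k < j)) ∧
    p ∈ segment ℝ (C.pt i) (C.pt j)}

/-- Every point of `S` is vertically below, or on, `U`. -/
def LiesBelow (S U : Set (ℝ × ℝ)) : Prop := ∀ p ∈ S, ∃ q ∈ U, q.1 = p.1 ∧ p.2 ≤ q.2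

/-- Every point of `S` is vertically above, or on, `L`. -/
def LiesAbove (S L : Set (ℝ × ℝ)) : Prop := ∀ p ∈ S, ∃ q ∈ L, q.1 = p.1 ∧ q.2 ≤ p.2

/-- The edges lying between the polyline through all points and the roof given by `R`. -/
def edgesUnder (C : NearEdge) (R : Set (Fin (C.n + 1))) :
    Set (Fin (C.n + 1) × Fin (C.n + 1)) :=
  {e ∈ C.edges | LiesAbove (segment ℝ (C.pt e.1) (C.pt e.2)) (C.polyline Set.univ) ∧
    LiesBelow (segment ℝ (C.pt e.1) (C.pt e.2)) (C.polyline R)}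

/-- `(R, T)` is an upper triangulation: `R` is the vertex set of a monotone polyline (the roof)
from the first to the last point that lies on or above the polyline through all points, and `T` is
a maximal set of non-intersecting edges in the region between the two. -/
structure IsUpperTriangulation (C : NearEdge) (R : Set (Fin (C.n + 1)))
    (T : Set (Fin (C.n + 1) × Fin (C.n + 1))) : Prop where
  first_mem : 0 ∈ R
  last_mem : Fin.last C.n ∈ R
  roof_above : LiesAbove (C.polyline R) (C.polyline Set.univ)
  maximal : Maximal (fun S => S ⊆ C.edgesUnder R ∧ C.NonCrossing S) T

/-- The number of upper triangulations whose roof has `i` segments, i.e. `i + 1` vertices. -/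
noncomputable def upperCount (C : NearEdge) (i : ℕ) : ℕ :=
  {RT : Set (Fin (C.n + 1)) × Set (Fin (C.n + 1) × Fin (C.n + 1)) |
    C.IsUpperTriangulation RT.1 RT.2 ∧ RT.1.ncard = i + 1}.ncard

/-- Two near-edges have the same number of points and the same order type. -/
def Equiv (C D : NearEdge) : Prop :=
  ∃ h : C.n = D.n, SameOrderType C.pt (fun i => D.pt (Fin.cast (by rw [h]) i))

theorem Equiv.refl (C : NearEdge) : C.Equiv C := ⟨rfl, fun _ _ _ => Iff.rfl⟩

theorem Equiv.symm {C D : NearEdge} (h : C.Equiv D) : D.Equiv C := by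
  obtain ⟨n, p, hp, gp⟩ := C
  obtain ⟨m, q, hq, gq⟩ := D
  obtain ⟨h, H⟩ := h
  dsimp only at h
  subst h
  exact ⟨rfl, fun i j k => (H i j k).symm⟩

theorem Equiv.trans {C D E : NearEdge} (h : C.Equiv D) (h' : D.Equiv E) : C.Equiv E := by
  obtain ⟨n, p, hp, gp⟩ := C
  obtain ⟨m, q, hq, gq⟩ := D
  obtain ⟨l, r, hr, gr⟩ := E
  obtain ⟨h, H⟩ := h
  obtain ⟨h', H'⟩ := h'
  dsimp only at h h'
  subst h
  subst h'
  exact ⟨rfl, fun i j k => (H i j k).trans (H' i j k)⟩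

/-- `C` is obtained from the triangle `(0, 0)`, `M`, `(2, 0)` by gluing `A` to the side from
`(0, 0)` to `M` and `B` to the side from `M` to `(2, 0)`: `σ` and `τ` are orientation-preserving
affine maps that move `A` and `B` there, the points of `C` are the points of `σ A` followed by those
of `τ B` (with the common point `M` listed once), and both pieces are near-edges of `C`. -/
def IsGluedSum (M : ℝ × ℝ) (A B C : NearEdge) : Prop :=
  ∃ σ τ : (ℝ × ℝ) →ᵃ[ℝ] (ℝ × ℝ),
    0 < LinearMap.det σ.linear ∧ 0 < LinearMap.det τ.linear ∧
    σ (A.pt 0) = (0, 0) ∧ σ (A.pt (Fin.last A.n)) = M ∧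
    τ (B.pt 0) = M ∧ τ (B.pt (Fin.last B.n)) = (2, 0) ∧
    IsNearEdgeOf (fun i => σ (A.pt i)) (fun j : Fin B.n => τ (B.pt j.succ)) ∧
    IsNearEdgeOf (fun j => τ (B.pt j)) (fun i : Fin A.n => σ (A.pt i.castSucc)) ∧
    ∃ h : C.n = A.n + B.n,
      (∀ i : Fin (A.n + 1), C.pt ⟨i, by omega⟩ = σ (A.pt i)) ∧
      (∀ j : Fin (B.n + 1), C.pt ⟨A.n + j, by omega⟩ = τ (B.pt j))

/-- The sum by gluing along a triangle with middle vertex `M`; a near-edge with a single point is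
by convention neutral. The sum is determined only up to order type, hence a relation. -/
def IsSum (M : ℝ × ℝ) (A B C : NearEdge) : Prop :=
  (A.n = 0 ∧ C.Equiv B) ∨ (B.n = 0 ∧ C.Equiv A) ∨ IsGluedSum M A B C

/-- `C` is (a representative of) the convex sum `A ∨ B`. -/
def IsConvexSum (A B C : NearEdge) : Prop := IsSum (1, -1) A B C

/-- `C` is (a representative of) the concave sum `A ∧ B`. -/
def IsConcaveSum (A B C : NearEdge) : Prop := IsSum (1, 1) A B C

end NearEdge

/-- A chain. -/
structure Chain extends NearEdge where
  isChain : toNearEdge.IsChain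

instance Chain.setoid : Setoid Chain where
  r C D := C.toNearEdge.Equiv D.toNearEdge
  iseqv := ⟨fun C => NearEdge.Equiv.refl C.toNearEdge, NearEdge.Equiv.symm, NearEdge.Equiv.trans⟩

/-- Chains up to order type. -/
def ChainType : Type := Quotient Chain.setoid

/-- The order type of a chain. -/
def Chain.type (C : Chain) : ChainType := Quotient.mk Chain.setoid C

/-- The linear map `ℚ[y] → ℚ[x]` with
`y ^ n ↦ ∑_{k ≤ n / 2} (-1) ^ k * binom (n - k) k * x ^ (n - k)`. -/
noncomputable def mapM : ℚ[X] →ₗ[ℚ] ℚ[X] :=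
  (Polynomial.basisMonomials ℚ).constr ℚ fun n =>
    ∑ k ∈ Finset.range (n / 2 + 1),
      Polynomial.C ((-1 : ℚ) ^ k * ((n - k).choose k : ℚ)) * X ^ (n - k)

/-- The polynomial `t_C`. A roof has at most `C.n` segments, and it has at least one unless the
chain is a single point. -/
noncomputable def Chain.t (C : Chain) : ℚ[X] :=
  ∑ i ∈ Finset.range (C.n + 1), Polynomial.C (C.upperCount i : ℚ) * X ^ i

/-- The polynomial `m_C`. -/
noncomputable def Chain.m (C : Chain) : ℚ[X] := mapM C.t

/-! The problem reduces to arcs over the integers. A near-edge is a chain exactly when no edge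
separates two consecutive points lying between its ends (`isChain_iff_uniform`); then no edge
crosses a step. Edges admitted in an upper triangulation are those with all intermediate points
below them, and two of these cross exactly when their index intervals interleave. So upper
triangulations of a chain are the dissections (`IsDissection`) of `upperArcs`, roof vertices are the
free vertices, and `Chain.t` becomes `dissectionPoly`.

Letting a piece collapse onto its side of the triangle shows that a glued sum consists of the order
types of both summands together with mixed triples of one constant orientation
(`IsGluedSum.isOrderSum`). This description determines the order type, is associative and preserves
chains. Sums exist because sufficiently flat copies can be glued, by a compactness argument
(`exists_isGluedSum`).

In a concave sum no admitted arc passes over the junction `a`, so a dissection is a pair of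
dissections and roof lengths add (`dissectionPoly_mul`).

In a convex sum every arc over `a` is admitted. Write p for `domino`: the transform sends y^n to
p_{n+1}, with p_{n+2} = x(p_{n+1} - p_n) and p_{u+v+1} = p_{u+1}p_{v+1} - x p_u p_v. If `a` is free
with u and v roof segments on its sides, the latter is the weight of the dissection. If a roof
segment spans `a`, with u segments before it and v after, the weight is p_{u+v+2} = x p_{u+1}p_{v+1}
- x p_u p_{v+1} - x p_{u+1}p_v. Removing that segment exposes a triangle; recording its apex is a
bijection onto dissections with a marked inner roof vertex that is `a` itself if `a` is free, and
otherwise an end of the roof segment over `a` (`sum_not_free_eq`). The apex has u+1 and v+1 roof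
segments on its sides, so the positive terms x p_{u+1}p_{v+1} turn into a sum over marked
dissections. That sum cancels all the negative terms (`sum_adjacent_eq`), marks at the two extreme
vertices being harmless since p_0 = 0. What is left is the sum of p_{u+1}p_{v+1} over pairs of
dissections. -/

/-! ### Dissections and their free vertices -/

/-- Two arcs over the integer line interleave. -/
def Interleave (e f : ℕ × ℕ) : Prop :=
  (e.1 < f.1 ∧ f.1 < e.2 ∧ e.2 < f.2) ∨ (f.1 < e.1 ∧ e.1 < f.2 ∧ f.2 < e.2)

theorem Interleave.symm {e f : ℕ × ℕ} (h : Interleave e f) : Interleave f e := Or.symm h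

/-- A set of arcs on `0, …, n` containing all the arcs between consecutive integers. -/
structure IsArcSet (n : ℕ) (E : Finset (ℕ × ℕ)) : Prop where
  lt : ∀ e ∈ E, e.1 < e.2
  le : ∀ e ∈ E, e.2 ≤ n
  step : ∀ i < n, (i, i + 1) ∈ E

/-- A set of pairwise non-interleaving arcs of `E`, containing all the arcs between consecutive
integers, that cannot be enlarged by arcs of `E` lying below one of its arcs. -/
structure IsDissection (n : ℕ) (E T : Finset (ℕ × ℕ)) : Prop where
  subset : T ⊆ E
  noncrossing : ∀ e ∈ T, ∀ f ∈ T, ¬ Interleave e f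
  step : ∀ i < n, (i, i + 1) ∈ T
  saturated : ∀ e ∈ E, ∀ f ∈ T, f.1 ≤ e.1 → e.2 ≤ f.2 → (∀ g ∈ T, ¬ Interleave e g) → e ∈ T

open Classical in
/-- The finite set of all dissections. -/
noncomputable def dissections (n : ℕ) (E : Finset (ℕ × ℕ)) : Finset (Finset (ℕ × ℕ)) :=
  E.powerset.filter (IsDissection n E)

theorem mem_dissections {n : ℕ} {E T : Finset (ℕ × ℕ)} :
    T ∈ dissections n E ↔ IsDissection n E T := by
  simp only [dissections, Finset.mem_filter, Finset.mem_powerset, and_iff_right_iff_imp]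
  exact fun h => h.subset

/-- The vertex `v` is not strictly below an arc of `T`. -/
def Free (T : Finset (ℕ × ℕ)) (v : ℕ) : Prop := ∀ e ∈ T, ¬ (e.1 < v ∧ v < e.2)

theorem free_zero (T : Finset (ℕ × ℕ)) : Free T 0 := fun _ _ h => absurd h.1 (by omega)

theorem free_insert {T : Finset (ℕ × ℕ)} {e : ℕ × ℕ} {v : ℕ} :
    Free (insert e T) v ↔ Free T v ∧ ¬ (e.1 < v ∧ v < e.2) := by
  simp only [Free, Finset.forall_mem_insert]
  exact and_comm

theorem Free.mono {S T : Finset (ℕ × ℕ)} (h : S ⊆ T) {v : ℕ} (hv : Free T v) : Free S v :=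
  fun e he => hv e (h he)

open Classical in
/-- The number of free vertices in `[lo, hi)`. -/
noncomputable def freeCount (T : Finset (ℕ × ℕ)) (lo hi : ℕ) : ℕ :=
  ((Finset.Ico lo hi).filter (Free T)).card

theorem freeCount_add (T : Finset (ℕ × ℕ)) {l m h : ℕ} (h₁ : l ≤ m) (h₂ : m ≤ h) :
    freeCount T l m + freeCount T m h = freeCount T l h := by
  classical
  unfold freeCount
  rw [← Finset.Ico_union_Ico_eq_Ico h₁ h₂, Finset.filter_union, Finset.card_union_of_disjoint]
  exact Finset.disjoint_filter_filter (Finset.Ico_disjoint_Ico_consecutive l m h)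

theorem freeCount_congr {S T : Finset (ℕ × ℕ)} {l h : ℕ}
    (H : ∀ v, l ≤ v → v < h → (Free S v ↔ Free T v)) : freeCount S l h = freeCount T l h := by
  classical
  unfold freeCount
  congr 1
  apply Finset.filter_congr
  intro v hv
  rw [Finset.mem_Ico] at hv
  exact H v hv.1 hv.2

/-- `r < t` are consecutive free vertices. -/
structure Consecutive (T : Finset (ℕ × ℕ)) (r t : ℕ) : Prop where
  lt : r < t
  left : Free T r
  right : Free T t
  between : ∀ v, r < v → v < t → ¬ Free T v

theorem Consecutive.freeCount {T : Finset (ℕ × ℕ)} {r t : ℕ} (h : Consecutive T r t) :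
    freeCount T r t = 1 := by
  classical
  rw [_root_.freeCount, Finset.card_eq_one]
  refine ⟨r, ?_⟩
  ext v
  simp only [Finset.mem_filter, Finset.mem_Ico, Finset.mem_singleton]
  constructor
  · rintro ⟨⟨h1, h2⟩, h3⟩
    by_contra hne
    exact h.between v (by omega) h2 h3
  · rintro rfl
    exact ⟨⟨le_rfl, h.lt⟩, h.left⟩

theorem freeCount_self (T : Finset (ℕ × ℕ)) (l : ℕ) : freeCount T l l = 0 := by
  simp [freeCount]

open Classical in
/-- The last free vertex not after `a`. -/
noncomputable def lastFree (T : Finset (ℕ × ℕ)) (a : ℕ) : ℕ := Nat.findGreatest (Free T) a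

theorem lastFree_le (T : Finset (ℕ × ℕ)) (a : ℕ) : lastFree T a ≤ a := by
  classical
  exact Nat.findGreatest_le _

theorem free_lastFree (T : Finset (ℕ × ℕ)) (a : ℕ) : Free T (lastFree T a) := by
  classical
  exact Nat.findGreatest_spec (Nat.zero_le a) (free_zero T)

theorem le_lastFree {T : Finset (ℕ × ℕ)} {a v : ℕ} (h : v ≤ a) (hv : Free T v) :
    v ≤ lastFree T a := by
  classical
  exact Nat.le_findGreatest h hv

/-- The first free vertex not before `a`. -/
noncomputable def firstFree (T : Finset (ℕ × ℕ)) (a : ℕ) : ℕ := sInf {v | a ≤ v ∧ Free T v}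

theorem exists_free_ge (T : Finset (ℕ × ℕ)) (a : ℕ) : {v | a ≤ v ∧ Free T v}.Nonempty := by
  -- Beyond the right ends of all arcs every vertex is free.
  refine ⟨a + T.sup Prod.snd, by omega, fun e he h => ?_⟩
  have : e.2 ≤ T.sup Prod.snd := Finset.le_sup (f := Prod.snd) he
  omega

theorem le_firstFree (T : Finset (ℕ × ℕ)) (a : ℕ) : a ≤ firstFree T a :=
  (Nat.sInf_mem (exists_free_ge T a)).1

theorem free_firstFree (T : Finset (ℕ × ℕ)) (a : ℕ) : Free T (firstFree T a) :=
  (Nat.sInf_mem (exists_free_ge T a)).2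

theorem firstFree_le {T : Finset (ℕ × ℕ)} {a v : ℕ} (h : a ≤ v) (hv : Free T v) :
    firstFree T a ≤ v := Nat.sInf_le ⟨h, hv⟩

/-- A covered vertex lies under exactly one roof segment, whose ends are the nearest free vertices
on either side. -/
theorem consecutive_around {T : Finset (ℕ × ℕ)} {a : ℕ} (h : ¬ Free T a) :
    Consecutive T (lastFree T a) (firstFree T a) ∧ lastFree T a < a ∧ a < firstFree T a := by
  have h1 := lastFree_le T a
  have h2 := le_firstFree T a
  have h3 : lastFree T a ≠ a := fun he => h (he ▸ free_lastFree T a)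
  have h4 : firstFree T a ≠ a := fun he => h (he ▸ free_firstFree T a)
  refine ⟨⟨by omega, free_lastFree T a, free_firstFree T a, fun v hv hv' hf => ?_⟩, by omega,
    by omega⟩
  rcases le_total v a with hva | hva
  · have := le_lastFree hva hf
    omega
  · have := firstFree_le hva hf
    omega

theorem Consecutive.eq_lastFree {T : Finset (ℕ × ℕ)} {r t a : ℕ} (h : Consecutive T r t)
    (h₁ : r ≤ a) (h₂ : a < t) : r = lastFree T a := by
  have h1 := le_lastFree h₁ h.left
  have h2 := lastFree_le T a
  by_contra hne
  exact h.between _ (by omega) (by omega) (free_lastFree T a)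

theorem Consecutive.eq_firstFree {T : Finset (ℕ × ℕ)} {r t a : ℕ} (h : Consecutive T r t)
    (h₁ : r < a) (h₂ : a ≤ t) : t = firstFree T a := by
  have h1 := firstFree_le h₂ h.right
  have h2 := le_firstFree T a
  by_contra hne
  exact h.between _ (by omega) (by omega) (free_firstFree T a)

namespace IsDissection

variable {n : ℕ} {E T : Finset (ℕ × ℕ)}

theorem free_last (hE : IsArcSet n E) (hT : IsDissection n E T) : Free T n := fun e he h => by
  have := hE.le e (hT.subset he)
  omega

/-- Consecutive free vertices are joined by an arc. -/
theorem mem_of_consecutive (hE : IsArcSet n E) (hT : IsDissection n E T) {r t : ℕ}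
    (h : Consecutive T r t) (ht : t ≤ n) : (r, t) ∈ T := by
  classical
  have hlt := h.lt
  have hne : (T.filter (fun e => e.1 = r)).Nonempty :=
    ⟨(r, r + 1), by simp [hT.step r (by omega)]⟩
  -- Take the longest arc `f` starting at `r`. If it stopped before `t`, its end would be covered by
  -- an arc that either starts at `r` and is longer, or starts under `f` and interleaves it.
  obtain ⟨f, hf, hmax⟩ := Finset.exists_max_image _ Prod.snd hne
  rw [Finset.mem_filter] at hf
  obtain ⟨hfT, hfr⟩ := hf
  have hf12 := hE.lt f (hT.subset hfT)
  have hft : ¬ (f.1 < t ∧ t < f.2) := h.right f hfT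
  rcases lt_or_ge f.2 t with hlt' | hge
  · exfalso
    have hnf := h.between f.2 (by omega) hlt'
    simp only [Free, not_forall, not_not] at hnf
    obtain ⟨g, hg, hg1, hg2⟩ := hnf
    have hgr := h.left g hg
    rcases eq_or_ne g.1 r with hgr' | hgr'
    · have := hmax g (by simp [hg, hgr'])
      omega
    · exact hT.noncrossing f hfT g hg (Or.inl ⟨by omega, by omega, by omega⟩)
  · have : f = (r, t) := Prod.ext hfr (by simp only; omega)
    exact this ▸ hfT

/-- An arc between free vertices interleaves no arc of the dissection. -/
theorem not_interleave_of_free {r t : ℕ} (hr : Free T r) (ht : Free T t) {g : ℕ × ℕ}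
    (hg : g ∈ T) : ¬ Interleave (r, t) g := by
  have h1 := hr g hg
  have h2 := ht g hg
  rintro (h | h) <;> simp only at h <;> omega

/-- Closing the triangle over three successive free vertices. -/
theorem insert_arc (hE : IsArcSet n E) (hT : IsDissection n E T) {r s t : ℕ}
    (h₁ : Consecutive T r s) (h₂ : Consecutive T s t) (ht : t ≤ n) (hrt : (r, t) ∈ E) :
    IsDissection n E (insert (r, t) T) := by
  have hlt₁ := h₁.lt
  have hlt₂ := h₂.lt
  have hrs := hT.mem_of_consecutive hE h₁ (by omega)
  have hst := hT.mem_of_consecutive hE h₂ ht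
  have hnc : ∀ g ∈ T, ¬ Interleave (r, t) g := fun g hg => not_interleave_of_free h₁.left h₂.right hg
  refine ⟨Finset.insert_subset hrt hT.subset, ?_, fun i hi => Finset.mem_insert_of_mem (hT.step i hi),
    ?_⟩
  · intro e he f hf
    rw [Finset.mem_insert] at he hf
    rcases he with rfl | he <;> rcases hf with rfl | hf
    · rintro (h | h) <;> omega
    · exact hnc f hf
    · exact fun h => hnc e he h.symm
    · exact hT.noncrossing e he f hf
  · intro e he f hf hfe hef hng
    have hng' : ∀ g ∈ T, ¬ Interleave e g := fun g hg => hng g (Finset.mem_insert_of_mem hg)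
    rw [Finset.mem_insert] at hf
    rcases hf with rfl | hf
    · simp only at hfe hef
      have hlt := hE.lt e he
      -- An arc below `(r, t)` that crosses neither side of the triangle lies below one of the sides
      -- or passes over `s`; in the last case it is forced to be `(r, t)`.
      have n1 := hng' _ hrs
      have n2 := hng' _ hst
      rcases le_or_gt e.2 s with hs | hs
      · exact Finset.mem_insert_of_mem (hT.saturated e he _ hrs hfe hs hng')
      rcases le_or_gt s e.1 with hs' | hs'
      · exact Finset.mem_insert_of_mem (hT.saturated e he _ hst hs' hef hng')
      have : e = (r, t) := by
        simp only [Interleave, not_or] at n1 n2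
        exact Prod.ext (by simp only; omega) (by simp only; omega)
      exact this ▸ Finset.mem_insert_self _ _
    · exact Finset.mem_insert_of_mem (hT.saturated e he f hf hfe hef hng')

/-- Removing an outermost arc. -/
theorem erase_arc (hE : IsArcSet n E) (hT : IsDissection n E T) {r t : ℕ}
    (hr : Free T r) (ht : Free T t) (hrt : r + 1 < t) :
    IsDissection n E (T.erase (r, t)) := by
  refine ⟨(Finset.erase_subset _ _).trans hT.subset, fun e he f hf => hT.noncrossing e
    (Finset.mem_of_mem_erase he) f (Finset.mem_of_mem_erase hf), fun i hi => ?_, ?_⟩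
  · refine Finset.mem_erase.2 ⟨fun h => ?_, hT.step i hi⟩
    rw [Prod.mk.injEq] at h
    omega
  · intro e he f hf hfe hef hng
    rw [Finset.mem_erase] at hf
    have h1 := hr f hf.2
    have h2 := ht f hf.2
    have hlt := hE.lt e he
    have hne : e ≠ (r, t) := by
      rintro rfl
      simp only at hfe hef
      exact hf.1 (Prod.ext (by simp only; omega) (by simp only; omega))
    refine Finset.mem_erase.2 ⟨hne, hT.saturated e he f hf.2 hfe hef fun g hg => ?_⟩
    by_cases hg' : g = (r, t)
    · subst hg'
      rintro (h | h) <;> simp only at h <;> omega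
    · exact hng g (Finset.mem_erase.2 ⟨hg', hg⟩)

end IsDissection

/-! ### Removing the roof segment over the junction -/

section Mixed

variable {n a : ℕ} {E : Finset (ℕ × ℕ)}

/-- The free vertices from which `a` can be seen from above: just `a` if it is free, the end points
of the outermost arc above `a` otherwise. -/
structure Adjacent (T : Finset (ℕ × ℕ)) (a s : ℕ) : Prop where
  free : Free T s
  right : ∀ v, s < v → v ≤ a → ¬ Free T v
  left : ∀ v, a ≤ v → v < s → ¬ Free T v

theorem adjacent_of_free {T : Finset (ℕ × ℕ)} (h : Free T a) {s : ℕ} :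
    Adjacent T a s ↔ s = a := by
  constructor
  · intro hs
    by_contra hne
    rcases lt_or_gt_of_ne hne with h' | h'
    · exact hs.right a h' le_rfl h
    · exact hs.left a le_rfl h' h
  · rintro rfl
    exact ⟨h, fun v h1 h2 => by omega, fun v h1 h2 => by omega⟩

theorem adjacent_of_not_free {T : Finset (ℕ × ℕ)} (h : ¬ Free T a) {s : ℕ} :
    Adjacent T a s ↔ s = lastFree T a ∨ s = firstFree T a := by
  obtain ⟨hc, h1, h2⟩ := consecutive_around h
  constructor
  · intro hs
    rcases le_total s a with h' | h'
    · left
      refine le_antisymm (le_lastFree h' hs.free) ?_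
      by_contra hlt
      exact hs.right _ (by omega) h1.le hc.left
    · right
      refine le_antisymm ?_ (firstFree_le h' hs.free)
      by_contra hlt
      exact hs.left _ h2.le (by omega) hc.right
  · rintro (rfl | rfl)
    · exact ⟨hc.left, fun v hv hv' => hc.between v hv (by omega), fun v hv hv' => by omega⟩
    · exact ⟨hc.right, fun v hv hv' => by omega, fun v hv hv' => hc.between v (by omega) hv'⟩

theorem consecutive_before {T : Finset (ℕ × ℕ)} {s : ℕ} (hs : Free T s) (h0 : 0 < s) :
    Consecutive T (lastFree T (s - 1)) s := by
  have h1 := lastFree_le T (s - 1)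
  refine ⟨by omega, free_lastFree T _, hs, fun v hv hv' hf => ?_⟩
  have := le_lastFree (a := s - 1) (by omega) hf
  omega

theorem consecutive_after {T : Finset (ℕ × ℕ)} {s : ℕ} (hs : Free T s) :
    Consecutive T s (firstFree T (s + 1)) := by
  have h1 := le_firstFree T (s + 1)
  refine ⟨by omega, hs, free_firstFree T _, fun v hv hv' hf => ?_⟩
  have := firstFree_le (a := s + 1) (by omega) hf
  omega

/-- After inserting the arc over three successive free vertices, its ends are consecutive. -/
theorem consecutive_insert {T : Finset (ℕ × ℕ)} {r s t : ℕ}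
    (h₁ : Consecutive T r s) (h₂ : Consecutive T s t) : Consecutive (insert (r, t) T) r t := by
  have := h₁.lt
  have := h₂.lt
  refine ⟨by omega, free_insert.2 ⟨h₁.left, by simp⟩, free_insert.2 ⟨h₂.right, by simp⟩, ?_⟩
  intro v hv hv' hf
  exact (free_insert.1 hf).2 ⟨hv, hv'⟩

/-- Removing the outermost arc above `a` exposes a triangle, if all arcs above `a` are allowed. -/
theorem exists_apex (hE : IsArcSet n E) (hmix : ∀ i j, i < a → a < j → j ≤ n → (i, j) ∈ E)
    {T : Finset (ℕ × ℕ)} (hT : IsDissection n E T) {r t : ℕ} (h : Consecutive T r t)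
    (hra : r < a) (hat : a < t) (htn : t ≤ n) :
    ∃ s, Consecutive (T.erase (r, t)) r s ∧ Consecutive (T.erase (r, t)) s t ∧
      Adjacent (T.erase (r, t)) a s := by
  set S := T.erase (r, t) with hS
  have hSd : IsDissection n E S := hT.erase_arc hE h.left h.right (by omega)
  have hST : S ⊆ T := Finset.erase_subset _ _
  have hr : Free S r := h.left.mono hST
  have ht : Free S t := h.right.mono hST
  have hrtT : (r, t) ∈ T := hT.mem_of_consecutive hE h htn
  have hrtS : (r, t) ∉ S := Finset.notMem_erase _ _
  -- an allowed arc below `(r, t)` between free vertices of `S`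
  have key : ∀ k l, r ≤ k → k < a → a < l → l ≤ t → (k, l) ≠ (r, t) → Free S k → Free S l →
      (k, l) ∈ S := by
    intro k l h1 h2 h3 h4 hne hk hl
    refine Finset.mem_erase.2 ⟨hne, hT.saturated _ (hmix k l h2 h3 (by omega)) _ hrtT h1 h4 ?_⟩
    intro g hg
    by_cases hg' : g = (r, t)
    · subst hg'
      rintro (h | h) <;> simp only at h <;> omega
    · exact IsDissection.not_interleave_of_free hk hl (Finset.mem_erase.2 ⟨hg', hg⟩)
  -- If `a` is exposed, it is the apex: another exposed `v` would allow `(v, t)` or `(r, v)`, which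
  -- by saturation is already present and covers `a`.
  by_cases ha : Free S a
  · refine ⟨a, ⟨hra, hr, ha, fun v hv hv' hf => ?_⟩, ⟨hat, ha, ht, fun v hv hv' hf => ?_⟩,
      (adjacent_of_free ha).2 rfl⟩
    · refine ha _ (key v t hv.le hv' hat le_rfl ?_ hf ht) ⟨hv', hat⟩
      rw [Ne, Prod.mk.injEq]
      omega
    · refine ha _ (key r v le_rfl hra hv hv'.le ?_ hr hf) ⟨hra, hv⟩
      rw [Ne, Prod.mk.injEq]
      omega
  · obtain ⟨hc, hk, hl⟩ := consecutive_around ha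
    set k := lastFree S a with hkdef
    set l := firstFree S a with hldef
    have hrk : r ≤ k := le_lastFree hra.le hr
    have hlt : l ≤ t := firstFree_le hat.le ht
    -- The exposed arc `(k, l)` over `a` must share exactly one end with `(r, t)`. Sharing both
    -- would put the erased arc back; sharing none would force `(r, l)` to be present and to cover
    -- `k`. The other end is the apex.
    rcases eq_or_lt_of_le hrk with hrk' | hrk'
    · have hlt' : l < t := by
        refine lt_of_le_of_ne hlt fun hlt' => hrtS ?_
        have := hSd.mem_of_consecutive hE hc (by omega)
        rwa [← hrk', hlt'] at this
      refine ⟨l, hrk' ▸ hc, ⟨hlt', hc.right, ht, fun v hv hv' hf => ?_⟩,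
        (adjacent_of_not_free ha).2 (Or.inr rfl)⟩
      refine hc.right _ (key r v le_rfl hra (by omega) hv'.le ?_ hr hf) ⟨by simp only; omega, hv⟩
      rw [Ne, Prod.mk.injEq]
      omega
    · have hlt' : l = t := by
        by_contra hne
        refine hc.left _ (key r l le_rfl hra hl hlt ?_ hr hc.right) ⟨hrk', by simp only; omega⟩
        rw [Ne, Prod.mk.injEq]
        omega
      refine ⟨k, ⟨hrk', hr, hc.left, fun v hv hv' hf => ?_⟩, hlt' ▸ hc,
        (adjacent_of_not_free ha).2 (Or.inl rfl)⟩
      refine hc.left _ (key v t hv.le (by omega) hat le_rfl ?_ hf ht) ⟨hv', by simp only; omega⟩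
      rw [Ne, Prod.mk.injEq]
      omega

end Mixed

section Mixed

variable {n a : ℕ} {E : Finset (ℕ × ℕ)}

theorem firstFree_succ_le (hE : IsArcSet n E) {T : Finset (ℕ × ℕ)} (hT : IsDissection n E T)
    {s : ℕ} (hs : s < n) : firstFree T (s + 1) ≤ n :=
  firstFree_le hs (hT.free_last hE)

/-- The neighbours of a marked vertex lie strictly on opposite sides of `a`, so the arc closing the
triangle spans `a` and is admitted by the convex hypothesis. -/
theorem Adjacent.lt_of_consecutive {T : Finset (ℕ × ℕ)} {s r t : ℕ} (h : Adjacent T a s)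
    (h₁ : Consecutive T r s) (h₂ : Consecutive T s t) : r < a ∧ a < t := by
  constructor
  · by_contra hlt
    exact h.left r (by omega) h₁.lt h₁.left
  · by_contra hlt
    exact h.right t h₂.lt (by omega) h₂.right

open Classical in
/-- If all arcs above `a` are allowed, removing the outermost arc above `a` is a bijection onto
dissections with a marked inner free vertex adjacent to `a`. -/
theorem sum_not_free_eq {M : Type*} [AddCommMonoid M] (h : ℕ → ℕ → M) (hE : IsArcSet n E)
    (hmix : ∀ i j, i < a → a < j → j ≤ n → (i, j) ∈ E) (han : a ≤ n) :
    ∑ T ∈ (dissections n E).filter (fun T => ¬ Free T a),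
        h (freeCount T 0 (lastFree T a) + 1) (freeCount T (firstFree T a) n + 1) =
      ∑ p ∈ (dissections n E ×ˢ Finset.Ioo 0 n).filter (fun p => Adjacent p.1 a p.2),
        h (freeCount p.1 0 p.2) (freeCount p.1 p.2 n) := by
  symm
  have data : ∀ p ∈ (dissections n E ×ˢ Finset.Ioo 0 n).filter (fun p => Adjacent p.1 a p.2),
      IsDissection n E p.1 ∧ Adjacent p.1 a p.2 ∧
      Consecutive p.1 (lastFree p.1 (p.2 - 1)) p.2 ∧
      Consecutive p.1 p.2 (firstFree p.1 (p.2 + 1)) ∧ firstFree p.1 (p.2 + 1) ≤ n ∧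
      lastFree p.1 (p.2 - 1) < a ∧ a < firstFree p.1 (p.2 + 1) := by
    rintro ⟨T, s⟩ hp
    simp only [Finset.mem_filter, Finset.mem_product, mem_dissections, Finset.mem_Ioo] at hp
    obtain ⟨⟨hT, h0, hn⟩, hadj⟩ := hp
    have c1 := consecutive_before hadj.free h0
    have c2 := consecutive_after hadj.free
    exact ⟨hT, hadj, c1, c2, firstFree_succ_le hE hT hn, hadj.lt_of_consecutive c1 c2⟩
  refine Finset.sum_bij
    (fun p _ => insert (lastFree p.1 (p.2 - 1), firstFree p.1 (p.2 + 1)) p.1) ?_ ?_ ?_ ?_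
  · intro p hp
    obtain ⟨hT, -, c1, c2, hn, hra, hat⟩ := data p hp
    refine Finset.mem_filter.2 ⟨mem_dissections.2
      (hT.insert_arc hE c1 c2 hn (hmix _ _ hra hat hn)), fun hf => ?_⟩
    exact (free_insert.1 hf).2 ⟨hra, hat⟩
  · intro p hp p' hp' heq
    obtain ⟨hT, -, c1, c2, hn, hra, hat⟩ := data p hp
    obtain ⟨hT', -, c1', c2', hn', hra', hat'⟩ := data p' hp'
    have d := consecutive_insert c1 c2
    have d' := consecutive_insert c1' c2'
    have notMem : ∀ {T : Finset (ℕ × ℕ)} {r s t : ℕ}, Consecutive T r s → Consecutive T s t →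
        (r, t) ∉ T := fun e1 e2 hm => e1.right _ hm ⟨e1.lt, e2.lt⟩
    have m := notMem c1 c2
    have m' := notMem c1' c2'
    obtain ⟨T, s⟩ := p
    obtain ⟨T', s'⟩ := p'
    simp only at *
    -- The new arc is the roof segment over `a` in the enlarged dissection, so its ends, and hence
    -- the old dissection, can be recovered.
    have er := (d.eq_lastFree hra.le hat).trans
      ((congrArg (lastFree · a) heq).trans (d'.eq_lastFree hra'.le hat').symm)
    have et := (d.eq_firstFree hra hat.le).trans
      ((congrArg (firstFree · a) heq).trans (d'.eq_firstFree hra' hat'.le).symm)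
    have eT : T = T' := by
      rw [← Finset.erase_insert m, heq, er, et, Finset.erase_insert m']
    subst eT
    -- The apex is recovered as the first free vertex after the left end of the removed arc.
    have e1 := c1.eq_firstFree (a := lastFree T (s - 1) + 1) (by omega) c1.lt
    have e2 := c1'.eq_firstFree (a := lastFree T (s' - 1) + 1) (by omega) c1'.lt
    rw [Prod.mk.injEq]
    exact ⟨rfl, by rw [e1, e2, er]⟩
  · intro T hT
    rw [Finset.mem_filter, mem_dissections] at hT
    obtain ⟨hT, hfree⟩ := hT
    obtain ⟨hc, hra, hat⟩ := consecutive_around hfree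
    have htn : firstFree T a ≤ n := firstFree_le han (hT.free_last hE)
    obtain ⟨s, c1, c2, hadj⟩ := exists_apex hE hmix hT hc hra hat htn
    have hlt1 := c1.lt
    have hlt2 := c2.lt
    refine ⟨(T.erase (lastFree T a, firstFree T a), s), ?_, ?_⟩
    · simp only [Finset.mem_filter, Finset.mem_product, mem_dissections, Finset.mem_Ioo]
      exact ⟨⟨hT.erase_arc hE hc.left hc.right (by omega), by omega, by omega⟩, hadj⟩
    · simp only
      rw [← c1.eq_lastFree (a := s - 1) (by omega) (by omega),
        ← c2.eq_firstFree (a := s + 1) (by omega) (by omega)]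
      exact Finset.insert_erase (hT.mem_of_consecutive hE hc htn)
  · intro p hp
    obtain ⟨hT, -, c1, c2, hn, hra, hat⟩ := data p hp
    have d := consecutive_insert c1 c2
    -- The two sides of the triangle account for the two summands `+ 1`; outside the new arc the
    -- free vertices are unchanged.
    rw [← d.eq_lastFree hra.le hat, ← d.eq_firstFree hra hat.le,
      ← freeCount_add p.1 (Nat.zero_le _) c1.lt.le, ← freeCount_add p.1 c2.lt.le hn,
      c1.freeCount, c2.freeCount, add_comm 1]
    congr 2
    · refine (freeCount_congr fun v _ hv => ?_).symm
      rw [free_insert, and_iff_left]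
      simp only
      omega
    · refine (freeCount_congr fun v hv _ => ?_).symm
      rw [free_insert, and_iff_left]
      simp only
      omega

-- Only inner vertices can be marked, but the vanishing of `h` when an argument is `0` allows the
-- marks `0` and `n` to be included. Then each dissection carries one mark if `a` is free and two
-- otherwise.
open Classical in
theorem sum_adjacent_eq {M : Type*} [AddCommMonoid M] (h : ℕ → ℕ → M) (h₀ : ∀ i, h 0 i = 0)
    (h₁ : ∀ i, h i 0 = 0) (hE : IsArcSet n E) (han : a ≤ n) :
    ∑ p ∈ (dissections n E ×ˢ Finset.Ioo 0 n).filter (fun p => Adjacent p.1 a p.2),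
        h (freeCount p.1 0 p.2) (freeCount p.1 p.2 n) =
      ∑ T ∈ (dissections n E).filter (fun T => Free T a),
        h (freeCount T 0 a) (freeCount T a n) +
      ∑ T ∈ (dissections n E).filter (fun T => ¬ Free T a),
        (h (freeCount T 0 (lastFree T a)) (freeCount T (lastFree T a) n) +
          h (freeCount T 0 (firstFree T a)) (freeCount T (firstFree T a) n)) := by
  rw [Finset.sum_filter, Finset.sum_product,
    ← Finset.sum_filter_add_sum_filter_not (dissections n E) (fun T => Free T a)]
  have inner : ∀ T ∈ dissections n E, ∀ S : Finset ℕ, (∀ s, s ∈ S ↔ Adjacent T a s) →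
      (∑ s ∈ Finset.Ioo 0 n, if Adjacent T a s then h (freeCount T 0 s) (freeCount T s n) else 0) =
      ∑ s ∈ S, h (freeCount T 0 s) (freeCount T s n) := by
    intro T hT S hS
    rw [← Finset.sum_filter]
    refine Finset.sum_subset (fun s hs => (hS s).2 (Finset.mem_filter.1 hs).2) ?_
    intro s hs hs'
    have hadj := (hS s).1 hs
    have hsn : s ≤ n := by
      by_contra hlt
      exact hadj.left n han (by omega) ((mem_dissections.1 hT).free_last hE)
    have : s = 0 ∨ s = n := by
      by_contra hne
      exact hs' (Finset.mem_filter.2 ⟨Finset.mem_Ioo.2 (by omega), hadj⟩)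
    rcases this with rfl | rfl
    · rw [freeCount_self, h₀]
    · rw [freeCount_self, h₁]
  congr 1
  · refine Finset.sum_congr rfl fun T hT => ?_
    rw [Finset.mem_filter] at hT
    rw [inner T hT.1 {a} (fun s => by rw [adjacent_of_free hT.2, Finset.mem_singleton]),
      Finset.sum_singleton]
  · refine Finset.sum_congr rfl fun T hT => ?_
    rw [Finset.mem_filter] at hT
    have hlt := (consecutive_around hT.2).1.lt
    rw [inner T hT.1 {lastFree T a, firstFree T a} (fun s => by
      rw [adjacent_of_not_free hT.2, Finset.mem_insert, Finset.mem_singleton]),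
      Finset.sum_pair hlt.ne]

end Mixed

/-! ### Cutting a dissection at a free vertex -/

section Glue

variable {a b : ℕ} {E₁ E₂ E : Finset (ℕ × ℕ)}

/-- The arcs of `S` followed by those of `T` shifted by `a`. -/
def glueArcs (a : ℕ) (S T : Finset (ℕ × ℕ)) : Finset (ℕ × ℕ) :=
  S ∪ T.image fun e => (e.1 + a, e.2 + a)

theorem mem_glueArcs {S T : Finset (ℕ × ℕ)} {e : ℕ × ℕ} :
    e ∈ glueArcs a S T ↔ e ∈ S ∨ ∃ f ∈ T, (f.1 + a, f.2 + a) = e := by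
  simp only [glueArcs, Finset.mem_union, Finset.mem_image]

theorem free_glueArcs_of_le {S T : Finset (ℕ × ℕ)} {v : ℕ} (hv : v ≤ a) :
    Free (glueArcs a S T) v ↔ Free S v := by
  refine ⟨fun h => h.mono Finset.subset_union_left, fun h e he => ?_⟩
  rcases mem_glueArcs.1 he with he | ⟨f, -, rfl⟩
  · exact h e he
  · simp only
    omega

theorem free_glueArcs_add {S T : Finset (ℕ × ℕ)} (hS : ∀ e ∈ S, e.2 ≤ a) {v : ℕ} :
    Free (glueArcs a S T) (v + a) ↔ Free T v := by
  constructor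
  · intro h e he
    have := h _ (mem_glueArcs.2 (Or.inr ⟨e, he, rfl⟩))
    simp only at this
    omega
  · intro h e he
    rcases mem_glueArcs.1 he with he | ⟨f, hf, rfl⟩
    · have := hS e he
      omega
    · have := h f hf
      simp only
      omega

theorem freeCount_shift {S T : Finset (ℕ × ℕ)} (h : ∀ v, Free S (v + a) ↔ Free T v) (n : ℕ) :
    freeCount S a (a + n) = freeCount T 0 n := by
  classical
  unfold freeCount
  symm
  refine Finset.card_bij (fun v _ => v + a) ?_ (fun v _ w _ h => by omega) ?_
  · intro v hv
    simp only [Finset.mem_filter, Finset.mem_Ico] at hv ⊢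
    exact ⟨by omega, (h v).2 hv.2⟩
  · intro w hw
    simp only [Finset.mem_filter, Finset.mem_Ico] at hw
    have hwa : w - a + a = w := by omega
    refine ⟨w - a, ?_, hwa⟩
    simp only [Finset.mem_filter, Finset.mem_Ico]
    exact ⟨by omega, (h _).1 (hwa.symm ▸ hw.2)⟩

theorem interleave_shift {e f : ℕ × ℕ} :
    Interleave (e.1 + a, e.2 + a) (f.1 + a, f.2 + a) ↔ Interleave e f := by
  simp only [Interleave]
  omega

theorem exists_shift_eq {e : ℕ × ℕ} (h₁ : a ≤ e.1) (h₂ : a ≤ e.2) :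
    ∃ f : ℕ × ℕ, (f.1 + a, f.2 + a) = e :=
  ⟨(e.1 - a, e.2 - a), Prod.ext (by simp only; omega) (by simp only; omega)⟩

/-- Every arc of the glued set lies in one half. Saturation only tests arcs below a present one, so
it can be checked in each half separately. -/
theorem IsDissection.glue (h₁ : IsArcSet a E₁) (h : IsArcSet (a + b) E)
    (hl : ∀ e : ℕ × ℕ, e.2 ≤ a → (e ∈ E ↔ e ∈ E₁))
    (hr : ∀ e : ℕ × ℕ, (e.1 + a, e.2 + a) ∈ E ↔ e ∈ E₂)
    {S T : Finset (ℕ × ℕ)} (hS : IsDissection a E₁ S) (hT : IsDissection b E₂ T) :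
    IsDissection (a + b) E (glueArcs a S T) := by
  have hSle : ∀ e ∈ S, e.2 ≤ a := fun e he => h₁.le e (hS.subset he)
  refine ⟨fun e he => ?_, fun e he f hf => ?_, fun i hi => ?_, fun e he f hf hfe hef hn => ?_⟩
  · rcases mem_glueArcs.1 he with he | ⟨f, hf, rfl⟩
    · exact (hl e (hSle e he)).2 (hS.subset he)
    · exact (hr f).2 (hT.subset hf)
  · rcases mem_glueArcs.1 he with he' | ⟨e, he', rfl⟩ <;>
      rcases mem_glueArcs.1 hf with hf' | ⟨f, hf', rfl⟩
    · exact hS.noncrossing e he' f hf'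
    · have := hSle e he'
      simp only [Interleave]
      omega
    · have := hSle f hf'
      simp only [Interleave]
      omega
    · exact fun hi => hT.noncrossing e he' f hf' (interleave_shift.1 hi)
  · rw [mem_glueArcs]
    rcases lt_or_ge i a with hia | hia
    · exact Or.inl (hS.step i hia)
    · refine Or.inr ⟨_, hT.step (i - a) (by omega), Prod.ext ?_ ?_⟩ <;> simp only <;> omega
  · have hlt := h.lt e he
    rcases mem_glueArcs.1 hf with hf' | ⟨f, hf', rfl⟩
    · have := hSle f hf'
      exact mem_glueArcs.2 (Or.inl (hS.saturated e ((hl e (by omega)).1 he) f hf' hfe hef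
        fun g hg => hn g (mem_glueArcs.2 (Or.inl hg))))
    · simp only at hfe hef
      obtain ⟨e, rfl⟩ := exists_shift_eq (a := a) (e := e) (by omega) (by omega)
      simp only at hfe hef
      refine mem_glueArcs.2 (Or.inr ⟨e, hT.saturated e ((hr e).1 he) f hf' (by omega) (by omega)
        fun g hg hi => ?_, rfl⟩)
      exact hn _ (mem_glueArcs.2 (Or.inr ⟨g, hg, rfl⟩)) (interleave_shift.2 hi)

theorem IsDissection.exists_glue (h₁ : IsArcSet a E₁) (h₂ : IsArcSet b E₂)
    (h : IsArcSet (a + b) E) (hl : ∀ e : ℕ × ℕ, e.2 ≤ a → (e ∈ E ↔ e ∈ E₁))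
    (hr : ∀ e : ℕ × ℕ, (e.1 + a, e.2 + a) ∈ E ↔ e ∈ E₂)
    {U : Finset (ℕ × ℕ)} (hU : IsDissection (a + b) E U) (ha : Free U a) :
    ∃ S T, IsDissection a E₁ S ∧ IsDissection b E₂ T ∧ glueArcs a S T = U := by
  classical
  refine ⟨U.filter (fun e => e.2 ≤ a), E₂.filter (fun e => (e.1 + a, e.2 + a) ∈ U), ?_, ?_, ?_⟩
  · refine ⟨fun e he => ?_, fun e he f hf => hU.noncrossing e (Finset.filter_subset _ _ he) f
      (Finset.filter_subset _ _ hf), fun i hi => ?_, fun e he f hf hfe hef hn => ?_⟩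
    · rw [Finset.mem_filter] at he
      exact (hl e he.2).1 (hU.subset he.1)
    · exact Finset.mem_filter.2 ⟨hU.step i (by omega), hi⟩
    · rw [Finset.mem_filter] at hf
      have hea := h₁.le e he
      have hlt := h₁.lt e he
      refine Finset.mem_filter.2 ⟨hU.saturated e ((hl e hea).2 he) f hf.1 hfe hef fun g hg => ?_,
        hea⟩
      -- As `a` is free, an arc ending after `a` starts no earlier than `a` and cannot interleave an
      -- arc of the left half.
      rcases le_or_gt g.2 a with hga | hga
      · exact hn g (Finset.mem_filter.2 ⟨hg, hga⟩)
      · have := ha g hg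
        simp only [Interleave]
        omega
  · refine ⟨Finset.filter_subset _ _, fun e he f hf hi => ?_, fun i hi => ?_,
      fun e he f hf hfe hef hn => ?_⟩
    · rw [Finset.mem_filter] at he hf
      exact hU.noncrossing _ he.2 _ hf.2 (interleave_shift.2 hi)
    · refine Finset.mem_filter.2 ⟨h₂.step i hi, ?_⟩
      have := hU.step (i + a) (by omega)
      rwa [add_right_comm] at this
    · rw [Finset.mem_filter] at hf
      refine Finset.mem_filter.2 ⟨he, hU.saturated _ ((hr e).2 he) _ hf.2 (by simp only; omega)
        (by simp only; omega) fun g hg => ?_⟩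
      have hlt := h.lt g (hU.subset hg)
      have hlt' := h₂.lt e he
      rcases lt_or_ge g.1 a with hga | hga
      · have := ha g hg
        simp only [Interleave]
        omega
      · obtain ⟨g, rfl⟩ := exists_shift_eq (a := a) (e := g) hga (by omega)
        exact fun hi => hn g (Finset.mem_filter.2 ⟨(hr g).1 (hU.subset hg), hg⟩)
          (interleave_shift.1 hi)
  · ext e
    rw [mem_glueArcs]
    simp only [Finset.mem_filter]
    constructor
    · rintro (he | ⟨f, hf, rfl⟩)
      · exact he.1
      · exact hf.2
    · intro he
      have := ha e he
      have hlt := h.lt e (hU.subset he)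
      rcases le_or_gt e.2 a with hea | hea
      · exact Or.inl ⟨he, hea⟩
      · obtain ⟨e, rfl⟩ := exists_shift_eq (a := a) (e := e) (by omega) hea.le
        exact Or.inr ⟨e, ⟨(hr e).1 (hU.subset he), he⟩, rfl⟩

open Classical in
/-- Dissections in which `a` is free are pairs of dissections. -/
theorem sum_free_eq {M : Type*} [AddCommMonoid M] (g : ℕ → ℕ → M) (h₁ : IsArcSet a E₁)
    (h₂ : IsArcSet b E₂) (h : IsArcSet (a + b) E) (hl : ∀ e : ℕ × ℕ, e.2 ≤ a → (e ∈ E ↔ e ∈ E₁))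
    (hr : ∀ e : ℕ × ℕ, (e.1 + a, e.2 + a) ∈ E ↔ e ∈ E₂) :
    ∑ U ∈ (dissections (a + b) E).filter (fun U => Free U a),
        g (freeCount U 0 a) (freeCount U a (a + b)) =
      ∑ S ∈ dissections a E₁, ∑ T ∈ dissections b E₂, g (freeCount S 0 a) (freeCount T 0 b) := by
  rw [← Finset.sum_product']
  symm
  have hle : ∀ p ∈ dissections a E₁ ×ˢ dissections b E₂, IsDissection a E₁ p.1 ∧
      IsDissection b E₂ p.2 ∧ (∀ e ∈ p.1, e.2 ≤ a) ∧ ∀ e ∈ p.1, e.1 < a := by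
    rintro ⟨S, T⟩ hp
    simp only [Finset.mem_product, mem_dissections] at hp
    exact ⟨hp.1, hp.2, fun e he => h₁.le e (hp.1.subset he), fun e he =>
      (h₁.lt e (hp.1.subset he)).trans_le (h₁.le e (hp.1.subset he))⟩
  refine Finset.sum_bij (fun p _ => glueArcs a p.1 p.2) ?_ ?_ ?_ ?_
  · intro p hp
    obtain ⟨hS, hT, hS', -⟩ := hle p hp
    refine Finset.mem_filter.2 ⟨mem_dissections.2 (hS.glue h₁ h hl hr hT), ?_⟩
    rw [free_glueArcs_of_le le_rfl]
    exact hS.free_last h₁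
  · rintro ⟨S, T⟩ hp ⟨S', T'⟩ hp' heq
    obtain ⟨-, -, -, hlt⟩ := hle _ hp
    obtain ⟨-, -, -, hlt'⟩ := hle _ hp'
    simp only at heq hlt hlt'
    have hmem : ∀ e, e ∈ glueArcs a S T ↔ e ∈ glueArcs a S' T' := fun e => by rw [heq]
    simp only [mem_glueArcs] at hmem
    rw [Prod.mk.injEq]
    constructor
    · ext e
      constructor
      · intro he
        rcases (hmem e).1 (Or.inl he) with h | ⟨f, -, rfl⟩
        · exact h
        · exact absurd (hlt _ he) (by simp only; omega)
      · intro he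
        rcases (hmem e).2 (Or.inl he) with h | ⟨f, -, rfl⟩
        · exact h
        · exact absurd (hlt' _ he) (by simp only; omega)
    · have inj : ∀ e f : ℕ × ℕ, (f.1 + a, f.2 + a) = (e.1 + a, e.2 + a) → f = e := by
        intro e f h
        rw [Prod.mk.injEq] at h
        exact Prod.ext (by omega) (by omega)
      ext e
      constructor
      · intro he
        rcases (hmem _).1 (Or.inr ⟨e, he, rfl⟩) with h | ⟨f, hf, hfe⟩
        · exact absurd (hlt' _ h) (by simp only; omega)
        · exact inj e f hfe ▸ hf
      · intro he
        rcases (hmem _).2 (Or.inr ⟨e, he, rfl⟩) with h | ⟨f, hf, hfe⟩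
        · exact absurd (hlt _ h) (by simp only; omega)
        · exact inj e f hfe ▸ hf
  · intro U hU
    rw [Finset.mem_filter, mem_dissections] at hU
    obtain ⟨S, T, hS, hT, rfl⟩ := hU.1.exists_glue h₁ h₂ h hl hr hU.2
    exact ⟨(S, T), Finset.mem_product.2 ⟨mem_dissections.2 hS, mem_dissections.2 hT⟩, rfl⟩
  · intro p hp
    obtain ⟨-, -, hS, -⟩ := hle p hp
    rw [freeCount_shift (fun v => free_glueArcs_add hS),
      freeCount_congr fun v _ hv => free_glueArcs_of_le hv.le]

end Glue

/-! ### Generating polynomials and the linear transform -/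

/-- The generating polynomial of dissections by the number of segments of the roof. -/
noncomputable def dissectionPoly (n : ℕ) (E : Finset (ℕ × ℕ)) : ℚ[X] :=
  ∑ T ∈ dissections n E, X ^ freeCount T 0 n

theorem dissectionPoly_mul {a b : ℕ} {E₁ E₂ E : Finset (ℕ × ℕ)} (h₁ : IsArcSet a E₁)
    (h₂ : IsArcSet b E₂) (h : IsArcSet (a + b) E) (hl : ∀ e : ℕ × ℕ, e.2 ≤ a → (e ∈ E ↔ e ∈ E₁))
    (hr : ∀ e : ℕ × ℕ, (e.1 + a, e.2 + a) ∈ E ↔ e ∈ E₂)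
    (hno : ∀ e ∈ E, ¬ (e.1 < a ∧ a < e.2)) :
    dissectionPoly (a + b) E = dissectionPoly a E₁ * dissectionPoly b E₂ := by
  classical
  unfold dissectionPoly
  rw [Finset.sum_mul_sum]
  simp_rw [← pow_add]
  rw [← sum_free_eq (fun u v => (X : ℚ[X]) ^ (u + v)) h₁ h₂ h hl hr, Finset.filter_true_of_mem]
  · exact Finset.sum_congr rfl fun T _ => by rw [freeCount_add T (Nat.zero_le _) (by omega)]
  · exact fun T hT e he => hno e ((mem_dissections.1 hT).subset he)

/-- The polynomials `0, 1, x, x ^ 2 - x, …`, a shift of the images of the powers of `y`. -/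
noncomputable def domino : ℕ → ℚ[X]
  | 0 => 0
  | 1 => 1
  | n + 2 => X * (domino (n + 1) - domino n)

theorem domino_add (a b : ℕ) :
    domino (a + b + 1) = domino (a + 1) * domino (b + 1) - X * domino a * domino b := by
  induction a generalizing b with
  | zero => simp [domino]
  | succ a ih =>
    rw [show a + 1 + b + 1 = a + (b + 1) + 1 by ring, ih, show a + 1 + 1 = a + 2 by rfl,
      show b + 1 + 1 = b + 2 by rfl, domino, domino]
    ring

/-- The range can be extended from `n / 2` to `n` because the added binomial coefficients vanish;
this removes the floor before the recurrence is checked. -/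
theorem mapM_X_pow_eq_sum (n : ℕ) : mapM (X ^ n) = ∑ k ∈ Finset.range (n + 1),
    C ((-1 : ℚ) ^ k * ((n - k).choose k : ℚ)) * X ^ (n - k) := by
  have h : (X ^ n : ℚ[X]) = basisMonomials ℚ n := by
    rw [coe_basisMonomials, X_pow_eq_monomial]
  rw [mapM, h, Module.Basis.constr_basis]
  refine Finset.sum_subset (fun k hk => ?_) fun k hk hk' => ?_
  · rw [Finset.mem_range] at hk ⊢
    omega
  · rw [Finset.mem_range] at hk hk'
    rw [Nat.choose_eq_zero_of_lt (by omega)]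
    simp

/-- Both sides obey the recurrence of `domino`: on the coefficients it is Pascal's rule. -/
theorem mapM_X_pow (n : ℕ) : mapM (X ^ n) = domino (n + 1) := by
  induction n using Nat.twoStepInduction with
  | zero =>
    rw [mapM_X_pow_eq_sum]
    simp [domino]
  | one =>
    rw [mapM_X_pow_eq_sum]
    simp [domino, Finset.sum_range_succ]
  | more n ih₀ ih₁ =>
    rw [show n + 2 + 1 = (n + 1) + 2 by rfl, domino, ← ih₀, show n + 1 + 1 = n + 1 + 1 by rfl,
      ← ih₁, mapM_X_pow_eq_sum, mapM_X_pow_eq_sum, mapM_X_pow_eq_sum, Finset.sum_range_succ',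
      Finset.sum_range_succ, Finset.sum_range_succ' _ (n + 1), mul_sub, mul_add, Finset.mul_sum,
      Finset.mul_sum]
    have hterm : ∀ k ∈ Finset.range (n + 1),
        C ((-1 : ℚ) ^ (k + 1) * ((n + 2 - (k + 1)).choose (k + 1) : ℚ)) * X ^ (n + 2 - (k + 1)) =
        X * (C ((-1 : ℚ) ^ (k + 1) * ((n + 1 - (k + 1)).choose (k + 1) : ℚ)) *
          X ^ (n + 1 - (k + 1))) -
        X * (C ((-1 : ℚ) ^ k * ((n - k).choose k : ℚ)) * X ^ (n - k)) := by
      intro k hk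
      rw [Finset.mem_range] at hk
      -- With `n = m + k` the truncated subtractions disappear and Pascal's rule applies to `(m +
      -- 1).choose (k + 1)`.
      obtain ⟨m, rfl⟩ : ∃ m, n = m + k := ⟨n - k, by omega⟩
      rw [show m + k + 2 - (k + 1) = m + 1 by omega, show m + k + 1 - (k + 1) = m by omega,
        show m + k - k = m by omega, Nat.choose_succ_succ]
      push_cast
      simp only [map_mul, map_add, map_pow, map_neg, map_one]
      ring
    rw [Finset.sum_congr rfl hterm, Finset.sum_sub_distrib]
    simp [Nat.choose_eq_zero_of_lt]
    ring

theorem mapM_dissectionPoly (n : ℕ) (E : Finset (ℕ × ℕ)) :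
    mapM (dissectionPoly n E) = ∑ T ∈ dissections n E, domino (freeCount T 0 n + 1) := by
  simp only [dissectionPoly, map_sum, mapM_X_pow]

/-- The weights are expanded by the addition formula. The bijection that removes the roof segment
over the junction makes all terms cancel except those of the product. -/
theorem mapM_dissectionPoly_mul {a b : ℕ} {E₁ E₂ E : Finset (ℕ × ℕ)} (h₁ : IsArcSet a E₁)
    (h₂ : IsArcSet b E₂) (h : IsArcSet (a + b) E) (hl : ∀ e : ℕ × ℕ, e.2 ≤ a → (e ∈ E ↔ e ∈ E₁))
    (hr : ∀ e : ℕ × ℕ, (e.1 + a, e.2 + a) ∈ E ↔ e ∈ E₂)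
    (hmix : ∀ i j, i < a → a < j → j ≤ a + b → (i, j) ∈ E) :
    mapM (dissectionPoly (a + b) E) =
      mapM (dissectionPoly a E₁) * mapM (dissectionPoly b E₂) := by
  classical
  simp only [mapM_dissectionPoly]
  rw [Finset.sum_mul_sum, ← sum_free_eq (fun u v => domino (u + 1) * domino (v + 1)) h₁ h₂ h hl hr]
  -- Both evaluations of the sum over marked dissections, for the weight `X * domino u * domino v`.
  -- It vanishes at `u = 0` and `v = 0`, as `sum_adjacent_eq` requires.
  have key := (sum_not_free_eq (fun u v => X * domino u * domino v) h hmix (by omega)).trans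
    (sum_adjacent_eq (fun u v => X * domino u * domino v) (by simp [domino]) (by simp [domino]) h
      (by omega))
  rw [← Finset.sum_filter_add_sum_filter_not (dissections (a + b) E) (fun T => Free T a)]
  have e1 : ∀ T ∈ (dissections (a + b) E).filter (fun T => Free T a),
      domino (freeCount T 0 (a + b) + 1) =
        domino (freeCount T 0 a + 1) * domino (freeCount T a (a + b) + 1) -
          X * domino (freeCount T 0 a) * domino (freeCount T a (a + b)) := by
    intro T _
    rw [← domino_add, freeCount_add T (Nat.zero_le _) (by omega)]
  have e2 : ∀ T ∈ (dissections (a + b) E).filter (fun T => ¬ Free T a),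
      domino (freeCount T 0 (a + b) + 1) =
        X * domino (freeCount T 0 (lastFree T a) + 1) *
            domino (freeCount T (firstFree T a) (a + b) + 1) -
          (X * domino (freeCount T 0 (lastFree T a)) * domino (freeCount T (lastFree T a) (a + b)) +
            X * domino (freeCount T 0 (firstFree T a)) *
              domino (freeCount T (firstFree T a) (a + b))) := by
    intro T hT
    rw [Finset.mem_filter, mem_dissections] at hT
    obtain ⟨hc, hlo, hhi⟩ := consecutive_around hT.2
    have hn : firstFree T a ≤ a + b := firstFree_le (by omega) (hT.1.free_last h)
    -- The roof splits into the part before the segment over `a`, that one segment, and the part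
    -- after it. The addition formula is followed by one use of the recurrence on the left factor.
    rw [← freeCount_add T (Nat.zero_le _) hn, ← freeCount_add T (Nat.zero_le _) hc.lt.le,
      ← freeCount_add T hc.lt.le hn, hc.freeCount, domino_add, add_comm 1 (freeCount T _ (a + b)),
      show freeCount T 0 (lastFree T a) + 1 + 1 = freeCount T 0 (lastFree T a) + 2 by rfl, domino]
    ring
  rw [Finset.sum_congr rfl e1, Finset.sum_congr rfl e2, Finset.sum_sub_distrib,
    Finset.sum_sub_distrib, key]
  ring

/-! ### Orientation and crossing of segments in the plane -/

/-- Twice the signed area of a triangle. -/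
def orient (p q r : ℝ × ℝ) : ℝ := (q.1 - p.1) * (r.2 - p.2) - (q.2 - p.2) * (r.1 - p.1)

theorem ccw_iff {p q r : ℝ × ℝ} : Ccw p q r ↔ 0 < orient p q r := Iff.rfl

theorem orient_rotate (p q r : ℝ × ℝ) : orient q r p = orient p q r := by
  unfold orient
  ring

theorem orient_swap (p q r : ℝ × ℝ) : orient q p r = -orient p q r := by
  unfold orient
  ring

theorem orient_eq_zero_of_collinear {p q r : ℝ × ℝ} (h : Collinear ℝ {p, q, r}) :
    orient p q r = 0 := by
  rw [collinear_iff_of_mem (p₀ := p) (by simp)] at h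
  obtain ⟨v, hv⟩ := h
  obtain ⟨s, rfl⟩ := hv q (by simp)
  obtain ⟨t, rfl⟩ := hv r (by simp)
  simp only [orient, vadd_eq_add, Prod.fst_add, Prod.snd_add, Prod.smul_fst, Prod.smul_snd,
    smul_eq_mul]
  ring

theorem collinear_of_orient_eq_zero {p q r : ℝ × ℝ} (hpq : p.1 < q.1) (h : orient p q r = 0) :
    Collinear ℝ {p, q, r} := by
  have hne : q.1 - p.1 ≠ 0 := by linarith
  rw [collinear_iff_of_mem (p₀ := p) (by simp)]
  refine ⟨q - p, ?_⟩
  have hr : r = ((r.1 - p.1) / (q.1 - p.1)) • (q - p) +ᵥ p := by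
    apply Prod.ext
    · simp only [vadd_eq_add, Prod.fst_add, Prod.smul_fst, Prod.fst_sub, smul_eq_mul]
      field_simp
      ring
    · simp only [vadd_eq_add, Prod.snd_add, Prod.smul_snd, Prod.snd_sub, smul_eq_mul]
      unfold orient at h
      field_simp
      linarith
  simp only [Set.mem_insert_iff, Set.mem_singleton_iff, forall_eq_or_imp, forall_eq]
  exact ⟨⟨0, by simp⟩, ⟨1, by simp⟩, ⟨_, hr⟩⟩

/-- The second coordinate at `x` of the line through `p` and `q`. -/
noncomputable def height (p q : ℝ × ℝ) (x : ℝ) : ℝ := p.2 + (q.2 - p.2) / (q.1 - p.1) * (x - p.1)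

theorem height_left (p q : ℝ × ℝ) : height p q p.1 = p.2 := by simp [height]

theorem height_right {p q : ℝ × ℝ} (h : p.1 < q.1) : height p q q.1 = q.2 := by
  have hne : q.1 - p.1 ≠ 0 := by linarith
  unfold height
  field_simp
  ring

/-- Affine interpolation with the denominator cleared, which therefore needs no assumption on `x`,
`y` or the slope. -/
theorem height_interpolate (p q : ℝ × ℝ) (x y z : ℝ) :
    height p q z * (y - x) = height p q x * (y - z) + height p q y * (z - x) := by
  unfold height
  ring

theorem ccw_iff_lt_height {p q r : ℝ × ℝ} (h : p.1 < r.1) :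
    Ccw p q r ↔ q.2 < height p r q.1 := by
  have hpos : 0 < r.1 - p.1 := by linarith
  have : height p r q.1 - q.2 = orient p q r / (r.1 - p.1) := by
    unfold height orient
    field_simp
    ring
  rw [ccw_iff, ← sub_pos (b := q.2), this]
  exact (div_pos_iff_of_pos_right hpos).symm

theorem mem_segment_iff_height {p q z : ℝ × ℝ} (h : p.1 < q.1) :
    z ∈ segment ℝ p q ↔ p.1 ≤ z.1 ∧ z.1 ≤ q.1 ∧ z.2 = height p q z.1 := by
  have hpos : 0 < q.1 - p.1 := by linarith
  rw [segment_eq_image]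
  constructor
  · rintro ⟨t, ⟨h0, h1⟩, rfl⟩
    simp only [Prod.fst_add, Prod.snd_add, Prod.smul_fst, Prod.smul_snd, smul_eq_mul]
    refine ⟨by nlinarith, by nlinarith, ?_⟩
    unfold height
    field_simp
    ring
  · rintro ⟨h0, h1, h2⟩
    refine ⟨(z.1 - p.1) / (q.1 - p.1), ⟨by apply div_nonneg <;> linarith, ?_⟩, ?_⟩
    · rw [div_le_one hpos]
      linarith
    · apply Prod.ext
      · simp only [Prod.fst_add, Prod.smul_fst, smul_eq_mul]
        field_simp
        ring
      · simp only [Prod.snd_add, Prod.smul_snd, smul_eq_mul]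
        rw [h2]
        unfold height
        field_simp
        ring

theorem mem_openSegment_iff_height {p q z : ℝ × ℝ} (h : p.1 < q.1) :
    z ∈ openSegment ℝ p q ↔ p.1 < z.1 ∧ z.1 < q.1 ∧ z.2 = height p q z.1 := by
  have hpos : 0 < q.1 - p.1 := by linarith
  rw [openSegment_eq_image]
  constructor
  · rintro ⟨t, ⟨h0, h1⟩, rfl⟩
    simp only [Prod.fst_add, Prod.snd_add, Prod.smul_fst, Prod.smul_snd, smul_eq_mul]
    refine ⟨by nlinarith, by nlinarith, ?_⟩
    unfold height
    field_simp
    ring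
  · rintro ⟨h0, h1, h2⟩
    refine ⟨(z.1 - p.1) / (q.1 - p.1), ⟨by apply div_pos <;> linarith, ?_⟩, ?_⟩
    · rw [div_lt_one hpos]
      linarith
    · apply Prod.ext
      · simp only [Prod.fst_add, Prod.smul_fst, smul_eq_mul]
        field_simp
        ring
      · simp only [Prod.snd_add, Prod.smul_snd, smul_eq_mul]
        rw [h2]
        unfold height
        field_simp
        ring

/-- The difference of the two affine heights changes sign between `x` and `y`, so it vanishes at an
interior point. -/
theorem not_disjoint_of_height_lt {p q r s : ℝ × ℝ} (hpq : p.1 < q.1) (hrs : r.1 < s.1) {x y : ℝ}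
    (hxy : x < y) (hp : p.1 ≤ x) (hq : y ≤ q.1) (hr : r.1 ≤ x) (hs : y ≤ s.1)
    (hx : height r s x < height p q x) (hy : height p q y < height r s y) :
    ¬ Disjoint (openSegment ℝ p q) (openSegment ℝ r s) := by
  rw [Set.not_disjoint_iff]
  set d := height p q x - height r s x with hd
  set e := height r s y - height p q y with he
  have hd0 : 0 < d := by linarith
  have he0 : 0 < e := by linarith
  have hde : 0 < d + e := by linarith
  -- The crossing divides the interval in the ratio `d : e` of the two vertical gaps.
  set z := x + (y - x) * (d / (d + e)) with hz
  have hfrac : 0 < d / (d + e) := by positivity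
  have hfrac' : d / (d + e) < 1 := by rw [div_lt_one hde]; linarith
  have hz1 : x < z := by nlinarith
  have hz2 : z < y := by nlinarith
  have hh : height p q z = height r s z := by
    have h1 := height_interpolate p q x y z
    have h2 := height_interpolate r s x y z
    have h3 : (z - x) * (d + e) = (y - x) * d := by
      rw [hz]
      field_simp
      ring
    have h4 : (height p q z - height r s z) * (y - x) = 0 := by
      rw [sub_mul, h1, h2]
      linear_combination -h3 + (y - z) * hd.symm - (z - x) * he.symm
    rcases mul_eq_zero.1 h4 with h | h <;> linarith
  refine ⟨(z, height p q z), ?_, ?_⟩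
  · rw [mem_openSegment_iff_height hpq]
    exact ⟨by simp only; linarith, by simp only; linarith, rfl⟩
  · rw [mem_openSegment_iff_height hrs]
    exact ⟨by simp only; linarith, by simp only; linarith, hh⟩

/-- A line that is weakly above another one at the ends of an interval, and not equal to it at both
ends, is above it inside. -/
theorem height_lt_of_le {p q r s : ℝ × ℝ} {x y z : ℝ} (hxz : x < z) (hzy : z < y)
    (hx : height p q x ≤ height r s x) (hy : height p q y ≤ height r s y)
    (hne : height p q x < height r s x ∨ height p q y < height r s y) :
    height p q z < height r s z := by
  have h1 := height_interpolate p q x y z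
  have h2 := height_interpolate r s x y z
  have hyx : 0 < y - x := by linarith
  refine lt_of_mul_lt_mul_right ?_ hyx.le
  rw [h1, h2]
  rcases hne with h | h
  · have := mul_lt_mul_of_pos_right h (show 0 < y - z by linarith)
    have := mul_le_mul_of_nonneg_right hy (show 0 ≤ z - x by linarith)
    linarith
  · have := mul_le_mul_of_nonneg_right hx (show 0 ≤ y - z by linarith)
    have := mul_lt_mul_of_pos_right h (show 0 < z - x by linarith)
    linarith

theorem height_le_of_le {p q r s : ℝ × ℝ} {x y z : ℝ} (hxy : x < y) (hxz : x ≤ z) (hzy : z ≤ y)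
    (hx : height p q x ≤ height r s x) (hy : height p q y ≤ height r s y) :
    height p q z ≤ height r s z := by
  have h1 := height_interpolate p q x y z
  have h2 := height_interpolate r s x y z
  have hyx : 0 < y - x := by linarith
  refine le_of_mul_le_mul_right ?_ hyx
  rw [h1, h2]
  have := mul_le_mul_of_nonneg_right hx (show 0 ≤ y - z by linarith)
  have := mul_le_mul_of_nonneg_right hy (show 0 ≤ z - x by linarith)
  linarith

theorem disjoint_openSegment_of_height {p q r s : ℝ × ℝ} (hpq : p.1 < q.1) (hrs : r.1 < s.1)
    (h : ∀ x, p.1 < x → x < q.1 → r.1 < x → x < s.1 → height p q x ≠ height r s x) :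
    Disjoint (openSegment ℝ p q) (openSegment ℝ r s) := by
  rw [Set.disjoint_left]
  intro z hz hz'
  rw [mem_openSegment_iff_height hpq] at hz
  rw [mem_openSegment_iff_height hrs] at hz'
  exact h z.1 hz.1 hz.2.1 hz'.1 hz'.2.1 (hz.2.2.symm.trans hz'.2.2)

/-! ### Chains and crossing edges in terms of orientations -/

namespace NearEdge

variable (C : NearEdge)

/-- The `i`-th point, for a natural number `i ≤ C.n`. -/
def node (i : ℕ) : ℝ × ℝ := C.pt ⟨min i C.n, by omega⟩

theorem node_eq {i : ℕ} (h : i < C.n + 1) : C.node i = C.pt ⟨i, h⟩ := by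
  unfold node
  congr 2
  omega

theorem node_val (i : Fin (C.n + 1)) : C.node i = C.pt i := C.node_eq i.2

variable {C}

theorem node_fst_lt {i j : ℕ} (h : i < j) (hj : j ≤ C.n) : (C.node i).1 < (C.node j).1 := by
  rw [C.node_eq (by omega), C.node_eq (by omega)]
  exact C.strictMono_fst (Fin.mk_lt_mk.2 h)

theorem node_fst_le {i j : ℕ} (h : i ≤ j) (hj : j ≤ C.n) : (C.node i).1 ≤ (C.node j).1 := by
  rcases h.eq_or_lt with rfl | h
  · exact le_rfl
  · exact (node_fst_lt h hj).le

theorem orient_node_ne_zero {i j k : ℕ} (hij : i < j) (hjk : j < k) (hk : k ≤ C.n) :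
    orient (C.node i) (C.node j) (C.node k) ≠ 0 := by
  intro h
  have hc := collinear_of_orient_eq_zero (node_fst_lt hij (by omega)) h
  rw [C.node_eq (by omega), C.node_eq (by omega), C.node_eq (by omega)] at hc
  exact C.general _ _ _ (Fin.mk_lt_mk.2 hij) (Fin.mk_lt_mk.2 hjk) hc

variable (C) in
/-- The triple of points with the given indices is in counterclockwise order. -/
def CcwAt (i j k : ℕ) : Prop := Ccw (C.node i) (C.node j) (C.node k)

theorem ccwAt_iff_lt {i k j : ℕ} (hij : i < j) (hj : j ≤ C.n) :
    C.CcwAt i k j ↔ (C.node k).2 < height (C.node i) (C.node j) (C.node k).1 :=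
  ccw_iff_lt_height (node_fst_lt hij hj)

/-- General position excludes equality, so failing to be below means being strictly above. -/
theorem not_ccwAt_iff_lt {i k j : ℕ} (hik : i < k) (hkj : k < j) (hj : j ≤ C.n) :
    ¬ C.CcwAt i k j ↔ height (C.node i) (C.node j) (C.node k).1 < (C.node k).2 := by
  rw [ccwAt_iff_lt (by omega) hj, not_lt]
  refine ⟨fun h => lt_of_le_of_ne h fun he => ?_, le_of_lt⟩
  apply orient_node_ne_zero hik hkj hj
  have h1 := node_fst_lt (C := C) (i := i) (j := j) (by omega) hj
  have hne : (C.node j).1 - (C.node i).1 ≠ 0 := by linarith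
  unfold height at he
  unfold orient
  field_simp at he
  linarith

/-- All points between `i` and `j` are below the segment. -/
theorem disjoint_of_below {i j k l : ℕ} (hik : i ≤ k) (hkl : k < l) (hlj : l ≤ j) (hj : j ≤ C.n)
    (hne : i < k ∨ l < j) (hk : i < k → C.CcwAt i k j) (hl : l < j → C.CcwAt i l j) :
    Disjoint (openSegment ℝ (C.node k) (C.node l)) (openSegment ℝ (C.node i) (C.node j)) := by
  have hij := node_fst_lt (C := C) (i := i) (j := j) (by omega) hj
  have hkl' := node_fst_lt (C := C) hkl (by omega)
  refine disjoint_openSegment_of_height hkl' hij fun x h1 h2 _ _ => ne_of_lt ?_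
  rw [ccwAt_iff_lt (by omega) hj] at hk hl
  refine height_lt_of_le h1 h2 ?_ ?_ ?_
  · rw [height_left]
    rcases hik.eq_or_lt with rfl | h
    · rw [height_left]
    · exact (hk h).le
  · rw [height_right hkl']
    rcases hlj.eq_or_lt with rfl | h
    · rw [height_right hij]
    · exact (hl h).le
  · rw [height_left, height_right hkl']
    exact hne.imp hk hl

theorem disjoint_of_above {i j k l : ℕ} (hik : i ≤ k) (hkl : k < l) (hlj : l ≤ j) (hj : j ≤ C.n)
    (hne : i < k ∨ l < j) (hk : i < k → ¬ C.CcwAt i k j) (hl : l < j → ¬ C.CcwAt i l j) :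
    Disjoint (openSegment ℝ (C.node k) (C.node l)) (openSegment ℝ (C.node i) (C.node j)) := by
  have hij := node_fst_lt (C := C) (i := i) (j := j) (by omega) hj
  have hkl' := node_fst_lt (C := C) hkl (by omega)
  refine disjoint_openSegment_of_height hkl' hij fun x h1 h2 _ _ => ne_of_gt ?_
  have hk' := fun h : i < k => (not_ccwAt_iff_lt h (by omega) hj).1 (hk h)
  have hl' := fun h : l < j => (not_ccwAt_iff_lt (by omega) h hj).1 (hl h)
  refine height_lt_of_le h1 h2 ?_ ?_ ?_
  · rw [height_left]
    rcases hik.eq_or_lt with rfl | h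
    · rw [height_left]
    · exact (hk' h).le
  · rw [height_right hkl']
    rcases hlj.eq_or_lt with rfl | h
    · rw [height_right hij]
    · exact (hl' h).le
  · rw [height_left, height_right hkl']
    exact hne.imp hk' hl'

theorem disjoint_of_le {i j k l : ℕ} (hij : i < j) (hjk : j ≤ k) (hkl : k < l) (hl : l ≤ C.n) :
    Disjoint (openSegment ℝ (C.node i) (C.node j)) (openSegment ℝ (C.node k) (C.node l)) := by
  refine disjoint_openSegment_of_height (node_fst_lt hij (by omega)) (node_fst_lt hkl hl)
    fun x _ h2 h3 _ => ?_
  have := node_fst_le (C := C) hjk (by omega)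
  linarith

theorem not_disjoint_of_ccwAt {i j k : ℕ} (hik : i < k) (hkj : k + 1 < j) (hj : j ≤ C.n)
    (h : ¬ (C.CcwAt i k j ↔ C.CcwAt i (k + 1) j)) :
    ¬ Disjoint (openSegment ℝ (C.node i) (C.node j))
      (openSegment ℝ (C.node k) (C.node (k + 1))) := by
  have hij := node_fst_lt (C := C) (i := i) (j := j) (by omega) hj
  have hkk := node_fst_lt (C := C) (i := k) (j := k + 1) (by omega) (by omega)
  have h1 := node_fst_lt (C := C) hik (by omega)
  have h2 := node_fst_lt (C := C) hkj hj
  have a1 := ccwAt_iff_lt (C := C) (i := i) (k := k) (j := j) (by omega) hj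
  have a2 := ccwAt_iff_lt (C := C) (i := i) (k := k + 1) (j := j) (by omega) hj
  have b1 := not_ccwAt_iff_lt (C := C) (i := i) (k := k) (j := j) (by omega) (by omega) hj
  have b2 := not_ccwAt_iff_lt (C := C) (i := i) (k := k + 1) (j := j) (by omega) (by omega) hj
  by_cases hk : C.CcwAt i k j
  · have hk' : ¬ C.CcwAt i (k + 1) j := fun hk' => h ⟨fun _ => hk', fun _ => hk⟩
    refine not_disjoint_of_height_lt hij hkk hkk h1.le h2.le le_rfl le_rfl ?_ ?_
    · rw [height_left]
      exact a1.1 hk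
    · rw [height_right hkk]
      exact b2.1 hk'
  · have hk' : C.CcwAt i (k + 1) j := by
      by_contra hk'
      exact h ⟨fun h => absurd h hk, fun h => absurd h hk'⟩
    rw [disjoint_comm]
    refine not_disjoint_of_height_lt hkk hij hkk le_rfl le_rfl h1.le h2.le ?_ ?_
    · rw [height_left]
      exact b1.1 hk
    · rw [height_right hkk]
      exact a2.1 hk'

theorem exists_isTriangulation {S : Set (Fin (C.n + 1) × Fin (C.n + 1))} (h : S ⊆ C.edges)
    (h' : C.NonCrossing S) : ∃ T, S ⊆ T ∧ C.IsTriangulation T := by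
  obtain ⟨T, hST, hT⟩ := (Set.toFinite {S | S ⊆ C.edges ∧ C.NonCrossing S}).exists_le_maximal
    (show S ∈ {S | S ⊆ C.edges ∧ C.NonCrossing S} from ⟨h, h'⟩)
  exact ⟨T, hST, hT⟩

theorem nonCrossing_insert {S : Set (Fin (C.n + 1) × Fin (C.n + 1))}
    {e : Fin (C.n + 1) × Fin (C.n + 1)} (h : C.NonCrossing S)
    (he : ∀ f ∈ S, f ≠ e → Disjoint (openSegment ℝ (C.pt e.1) (C.pt e.2))
      (openSegment ℝ (C.pt f.1) (C.pt f.2))) : C.NonCrossing (insert e S) := by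
  refine Set.Pairwise.insert h fun f hf hne => ⟨he f hf hne.symm, (he f hf hne.symm).symm⟩

variable (C) in
/-- No edge separates two consecutive points between its end points. -/
def Uniform : Prop :=
  ∀ i j k, i < k → k + 1 < j → j ≤ C.n → (C.CcwAt i k j ↔ C.CcwAt i (k + 1) j)

/-- By uniformity both ends of the step are on the same side of any edge spanning it, unless they
coincide with ends of that edge. -/
theorem disjoint_step {m i j : ℕ} (hC : C.Uniform)
    (hm : m < C.n) (hij : i < j) (hj : j ≤ C.n) (hne : (i, j) ≠ (m, m + 1)) :
    Disjoint (openSegment ℝ (C.node m) (C.node (m + 1)))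
      (openSegment ℝ (C.node i) (C.node j)) := by
  rcases le_or_gt j m with h1 | h1
  · exact (disjoint_of_le hij h1 (by omega) hm).symm
  rcases le_or_gt (m + 1) i with h2 | h2
  · exact disjoint_of_le (by omega) h2 hij hj
  have hne' : i < m ∨ m + 1 < j := by
    rw [Ne, Prod.mk.injEq] at hne
    omega
  have hu := hC i j m
  by_cases hcc : (i < m → C.CcwAt i m j) ∧ (m + 1 < j → C.CcwAt i (m + 1) j)
  · exact disjoint_of_below (by omega) (by omega) h1 hj hne' hcc.1 hcc.2
  · refine disjoint_of_above (by omega) (by omega) h1 hj hne' ?_ ?_ <;> tauto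

/-- An edge separating consecutive points crosses the step between them and extends to a
triangulation, which then omits the step. Conversely, under uniformity a step crosses nothing, so
maximality forces it into every triangulation. -/
theorem isChain_iff_uniform : C.IsChain ↔ C.Uniform := by
  constructor
  · intro hC i j k hik hkj hj
    by_contra h
    have hd := not_disjoint_of_ccwAt hik hkj hj h
    obtain ⟨T, hST, hT⟩ := exists_isTriangulation (C := C)
      (S := {(⟨i, by omega⟩, ⟨j, by omega⟩)})
      (by
        rintro e rfl
        exact Fin.mk_lt_mk.2 (by omega))
      (Set.pairwise_singleton _ _)
    have h1 := hC T hT ⟨k, by omega⟩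
    have h2 := hST rfl
    have := hT.prop.2 h2 h1 (by
      rw [Ne, Prod.mk.injEq, Fin.ext_iff, Fin.ext_iff]
      simp only [Fin.castSucc_mk]
      omega)
    simp only [Fin.castSucc_mk, Fin.succ_mk] at this
    rw [C.node_eq (i := i) (by omega), C.node_eq (i := j) (by omega),
      C.node_eq (i := k) (by omega), C.node_eq (i := k + 1) (by omega)] at hd
    exact hd this
  · intro hC T hT m
    refine hT.mem_of_prop_insert ⟨Set.insert_subset ?_ hT.prop.1,
      nonCrossing_insert hT.prop.2 fun f hf hne => ?_⟩
    · exact Fin.castSucc_lt_succ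
    · have := disjoint_step (C := C) (m := m) (i := f.1) (j := f.2) hC m.2 (hT.prop.1 hf)
        (by omega) (fun h => hne (by
          rw [Prod.mk.injEq] at h
          exact Prod.ext (Fin.ext h.1) (Fin.ext h.2)))
      rw [node_val, node_val] at this
      rwa [C.node_eq (i := m) (by omega), C.node_eq (i := m + 1) (by omega)] at this

variable (C) in
open Classical in
/-- The edges that lie weakly above the points between their ends. -/
noncomputable def upperArcs : Finset (ℕ × ℕ) :=
  (Finset.range (C.n + 1) ×ˢ Finset.range (C.n + 1)).filter
    fun e => e.1 < e.2 ∧ ∀ k, e.1 < k → k < e.2 → C.CcwAt e.1 k e.2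

theorem mem_upperArcs {e : ℕ × ℕ} : e ∈ C.upperArcs ↔
    e.1 < e.2 ∧ e.2 ≤ C.n ∧ ∀ k, e.1 < k → k < e.2 → C.CcwAt e.1 k e.2 := by
  simp only [upperArcs, Finset.mem_filter, Finset.mem_product, Finset.mem_range]
  constructor
  · rintro ⟨h1, h2, h3⟩
    exact ⟨h2, by omega, h3⟩
  · rintro ⟨h1, h2, h3⟩
    exact ⟨by omega, h1, h3⟩

variable (C) in
theorem isArcSet_upperArcs : IsArcSet C.n C.upperArcs where
  lt _ he := (mem_upperArcs.1 he).1
  le _ he := (mem_upperArcs.1 he).2.1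
  step i hi := mem_upperArcs.2 ⟨by simp, hi, fun k h1 h2 => by simp only at h1 h2; omega⟩

/-- At `f.1` the second edge starts below the first, and at `e.2` the first ends below the second,
so they cross in between. -/
theorem not_disjoint_of_interleave {e f : ℕ × ℕ} (he : e ∈ C.upperArcs) (hf : f ∈ C.upperArcs)
    (h1 : e.1 < f.1) (h2 : f.1 < e.2) (h3 : e.2 < f.2) :
    ¬ Disjoint (openSegment ℝ (C.node e.1) (C.node e.2))
      (openSegment ℝ (C.node f.1) (C.node f.2)) := by
  rw [mem_upperArcs] at he hf
  have he' := node_fst_lt he.1 he.2.1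
  have hf' := node_fst_lt hf.1 hf.2.1
  refine not_disjoint_of_height_lt he' hf' (node_fst_lt h2 (by omega))
    (node_fst_le h1.le (by omega)) le_rfl le_rfl (node_fst_le h3.le (by omega)) ?_ ?_
  · rw [height_left]
    exact (ccwAt_iff_lt he.1 he.2.1).1 (he.2.2 _ h1 h2)
  · rw [height_right he']
    exact (ccwAt_iff_lt hf.1 hf.2.1).1 (hf.2.2 _ h2 h3)

theorem disjoint_iff_not_interleave {e f : ℕ × ℕ} (he : e ∈ C.upperArcs) (hf : f ∈ C.upperArcs)
    (hne : e ≠ f) : Disjoint (openSegment ℝ (C.node e.1) (C.node e.2))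
      (openSegment ℝ (C.node f.1) (C.node f.2)) ↔ ¬ Interleave e f := by
  constructor
  · rintro hd (⟨h1, h2, h3⟩ | ⟨h1, h2, h3⟩)
    · exact not_disjoint_of_interleave he hf h1 h2 h3 hd
    · exact not_disjoint_of_interleave hf he h1 h2 h3 hd.symm
  · intro hn
    have he' := mem_upperArcs.1 he
    have hf' := mem_upperArcs.1 hf
    have hne' : e.1 ≠ f.1 ∨ e.2 ≠ f.2 := by
      by_contra h
      push Not at h
      exact hne (Prod.ext h.1 h.2)
    simp only [Interleave, not_or, not_and] at hn
    rcases le_or_gt e.2 f.1 with h1 | h1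
    · exact disjoint_of_le he'.1 h1 hf'.1 hf'.2.1
    rcases le_or_gt f.2 e.1 with h2 | h2
    · exact (disjoint_of_le hf'.1 h2 he'.1 he'.2.1).symm
    have : (e.1 ≤ f.1 ∧ f.2 ≤ e.2) ∨ (f.1 ≤ e.1 ∧ e.2 ≤ f.2) := by omega
    rcases this with ⟨h3, h4⟩ | ⟨h3, h4⟩
    · exact (disjoint_of_below h3 hf'.1 h4 he'.2.1 (by omega)
        (fun h => he'.2.2 _ h (by omega)) (fun h => he'.2.2 _ (by omega) h)).symm
    · exact disjoint_of_below h3 he'.1 h4 hf'.2.1 (by omega)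
        (fun h => hf'.2.2 _ h (by omega)) (fun h => hf'.2.2 _ (by omega) h)

end NearEdge

/-! ### Upper triangulations as dissections -/

namespace NearEdge

variable {C : NearEdge}

theorem eq_pt_of_mem_polyline {R : Set (Fin (C.n + 1))} {q : ℝ × ℝ} (hq : q ∈ C.polyline R)
    {k : Fin (C.n + 1)} (hk : k ∈ R) (h : q.1 = (C.pt k).1) : q = C.pt k := by
  obtain ⟨i, hi, j, hj, hij, hb, hq⟩ := hq
  have hlt := C.strictMono_fst hij
  rw [mem_segment_iff_height hlt] at hq
  obtain ⟨h1, h2, h3⟩ := hq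
  rw [h] at h1 h2
  have h1' := C.strictMono_fst.le_iff_le.1 h1
  have h2' := C.strictMono_fst.le_iff_le.1 h2
  refine Prod.ext h ?_
  rw [h3, h]
  rcases h1'.eq_or_lt with rfl | h1'
  · exact height_left _ _
  rcases h2'.eq_or_lt with rfl | h2'
  · exact height_right hlt
  · exact absurd ⟨h1', h2'⟩ (hb k hk)

/-- Between consecutive vertices everything is affine, so lying above the polyline need only be
tested at the vertices. -/
theorem liesAbove_segment_iff {i j : Fin (C.n + 1)} (hij : i < j) :
    LiesAbove (segment ℝ (C.pt i) (C.pt j)) (C.polyline Set.univ) ↔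
      ((i : ℕ), (j : ℕ)) ∈ C.upperArcs := by
  have hlt := C.strictMono_fst hij
  have hjn : (j : ℕ) ≤ C.n := by omega
  rw [mem_upperArcs]
  constructor
  · intro h
    refine ⟨hij, hjn, fun k h1 h2 => ?_⟩
    simp only at h1 h2 ⊢
    by_contra hcc
    have hlow := (not_ccwAt_iff_lt h1 h2 hjn).1 hcc
    rw [node_val, node_val] at hlow
    have hk1 := node_fst_lt (C := C) h1 (by omega)
    have hk2 := node_fst_lt (C := C) h2 hjn
    rw [node_val] at hk1 hk2
    -- Test the point of the segment exactly below the offending vertex: the polyline meets that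
    -- vertical line only in the vertex.
    obtain ⟨q, hq, hq1, hq2⟩ := h ((C.node k).1, height (C.pt i) (C.pt j) (C.node k).1)
      ((mem_segment_iff_height hlt).2 ⟨hk1.le, hk2.le, rfl⟩)
    have := eq_pt_of_mem_polyline hq (k := ⟨k, by omega⟩) (Set.mem_univ _)
      (by rw [hq1, C.node_eq (by omega)])
    rw [← C.node_eq (by omega)] at this
    rw [this] at hq2
    simp only at hq2
    linarith
  · rintro ⟨-, -, h⟩ p hp
    simp only at h
    rw [mem_segment_iff_height hlt] at hp
    obtain ⟨h1, h2, h3⟩ := hp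
    have hle : ∀ k : ℕ, i ≤ k → k ≤ j →
        (C.node k).2 ≤ height (C.pt i) (C.pt j) (C.node k).1 := by
      intro k hk1 hk2
      rcases hk1.eq_or_lt with rfl | hk1
      · rw [node_val, height_left]
      rcases hk2.eq_or_lt with rfl | hk2
      · rw [node_val, height_right hlt]
      · have := (ccwAt_iff_lt (C := C) hij hjn).1 (h k hk1 hk2)
        rw [node_val, node_val] at this
        exact this.le
    -- the step of the polyline below `p`
    have hex : ∃ m : ℕ, i ≤ m ∧ m < j ∧ (C.node m).1 ≤ p.1 ∧ p.1 ≤ (C.node (m + 1)).1 := by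
      classical
      have hj : ∃ m : ℕ, i ≤ m ∧ p.1 ≤ (C.node (m + 1)).1 := by
        refine ⟨j - 1, by omega, ?_⟩
        rw [show (j : ℕ) - 1 + 1 = j by omega, node_val]
        exact h2
      have hm := Nat.find_spec hj
      refine ⟨Nat.find hj, hm.1, ?_, ?_, hm.2⟩
      · have : Nat.find hj ≤ j - 1 := Nat.find_min' hj ⟨by omega, by
          rw [show (j : ℕ) - 1 + 1 = j by omega, node_val]
          exact h2⟩
        omega
      · rcases hm.1.eq_or_lt with he | hlt'
        · rw [← he, node_val]
          exact h1
        · by_contra hp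
          have := Nat.find_min hj (m := Nat.find hj - 1) (by omega)
          refine this ⟨by omega, ?_⟩
          rw [show Nat.find hj - 1 + 1 = Nat.find hj by omega]
          exact (not_le.1 hp).le
    obtain ⟨m, him, hmj, hm1, hm2⟩ := hex
    have hmm := node_fst_lt (C := C) (i := m) (j := m + 1) (by omega) (by omega)
    refine ⟨(p.1, height (C.node m) (C.node (m + 1)) p.1), ?_, rfl, ?_⟩
    · refine ⟨⟨m, by omega⟩, Set.mem_univ _, ⟨m + 1, by omega⟩, Set.mem_univ _,
        Fin.mk_lt_mk.2 (by omega), fun k _ hk => ?_, ?_⟩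
      · rw [Fin.lt_def, Fin.lt_def] at hk
        simp only at hk
        omega
      · rw [← C.node_eq, ← C.node_eq, mem_segment_iff_height hmm]
        exact ⟨hm1, hm2, rfl⟩
    · simp only
      rw [h3]
      refine height_le_of_le hmm hm1 hm2 ?_ ?_
      · rw [height_left]
        exact hle m him hmj.le
      · rw [height_right hmm]
        exact hle (m + 1) (by omega) hmj

variable (C) in
/-- The vertex set of a monotone polyline above the polyline through all points. -/
structure IsRoof (R : Set (Fin (C.n + 1))) : Prop where
  first_mem : 0 ∈ R
  last_mem : Fin.last C.n ∈ R
  mem_upperArcs : ∀ i ∈ R, ∀ j ∈ R, i < j → (∀ k ∈ R, ¬ (i < k ∧ k < j)) →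
    ((i : ℕ), (j : ℕ)) ∈ C.upperArcs

theorem isRoof_iff {R : Set (Fin (C.n + 1))} : C.IsRoof R ↔
    0 ∈ R ∧ Fin.last C.n ∈ R ∧ LiesAbove (C.polyline R) (C.polyline Set.univ) := by
  constructor
  · rintro ⟨h0, hn, h⟩
    refine ⟨h0, hn, ?_⟩
    rintro p ⟨i, hi, j, hj, hij, hb, hp⟩
    exact (liesAbove_segment_iff hij).2 (h i hi j hj hij hb) p hp
  · rintro ⟨h0, hn, h⟩
    refine ⟨h0, hn, fun i hi j hj hij hb => (liesAbove_segment_iff hij).1 fun p hp => ?_⟩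
    exact h p ⟨i, hi, j, hj, hij, hb, hp⟩

/-- An edge below the roof is below one segment of the roof. -/
theorem IsRoof.exists_segment {R : Set (Fin (C.n + 1))} (hR : C.IsRoof R) {i j : Fin (C.n + 1)}
    (h : ∀ r ∈ R, ¬ (i < r ∧ r < j)) :
    ∃ r ∈ R, ∃ s ∈ R, r ≤ i ∧ j ≤ s ∧ ∀ k ∈ R, ¬ (r < k ∧ k < s) := by
  obtain ⟨r, ⟨hr, hri⟩, hrmax⟩ := Set.exists_max_image (R ∩ Set.Iic i) id (Set.toFinite _)
    ⟨0, hR.first_mem, Fin.zero_le _⟩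
  obtain ⟨s, ⟨hs, hjs⟩, hsmin⟩ := Set.exists_min_image (R ∩ Set.Ici j) id (Set.toFinite _)
    ⟨Fin.last _, hR.last_mem, Fin.le_last _⟩
  refine ⟨r, hr, s, hs, hri, hjs, fun k hk hrs => ?_⟩
  rcases le_or_gt k i with hki | hki
  · exact absurd (hrmax k ⟨hk, hki⟩) (not_le.2 hrs.1)
  rcases le_or_gt j k with hjk | hjk
  · exact absurd (hsmin k ⟨hk, hjk⟩) (not_le.2 hrs.2)
  · exact h k hk ⟨hki, hjk⟩

/-- An admitted edge passes strictly above each vertex inside its span, so a roof vertex there would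
put the edge above the roof. Otherwise the edge sits under a single roof segment, and comparing at
its two ends suffices. -/
theorem liesBelow_segment_iff {R : Set (Fin (C.n + 1))} (hR : C.IsRoof R) {i j : Fin (C.n + 1)}
    (h : ((i : ℕ), (j : ℕ)) ∈ C.upperArcs) :
    LiesBelow (segment ℝ (C.pt i) (C.pt j)) (C.polyline R) ↔ ∀ r ∈ R, ¬ (i < r ∧ r < j) := by
  obtain ⟨hij', hjn, hup⟩ := mem_upperArcs.1 h
  have hij : i < j := hij'
  have hlt := C.strictMono_fst hij
  constructor
  · rintro hb r hr ⟨h1, h2⟩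
    have hr1 := C.strictMono_fst h1
    have hr2 := C.strictMono_fst h2
    obtain ⟨q, hq, hq1, hq2⟩ := hb ((C.pt r).1, height (C.pt i) (C.pt j) (C.pt r).1)
      ((mem_segment_iff_height hlt).2 ⟨hr1.le, hr2.le, rfl⟩)
    rw [eq_pt_of_mem_polyline hq hr hq1] at hq2
    have := (ccwAt_iff_lt (C := C) hij' hjn).1 (hup r h1 h2)
    simp only [node_val] at this hq2
    linarith
  · intro hb p hp
    obtain ⟨r, hr, s, hs, hri, hjs, hrs⟩ := hR.exists_segment hb
    have hrs' : r < s := hri.trans_lt (hij.trans_le hjs)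
    obtain ⟨hrs'', hsn, hup'⟩ := mem_upperArcs.1 (hR.mem_upperArcs r hr s hs hrs' hrs)
    have hlt' := C.strictMono_fst hrs'
    rw [mem_segment_iff_height hlt] at hp
    have hle : ∀ k : Fin (C.n + 1), r ≤ k → k ≤ s →
        (C.pt k).2 ≤ height (C.pt r) (C.pt s) (C.pt k).1 := by
      intro k hk1 hk2
      rcases hk1.eq_or_lt with rfl | hk1
      · rw [height_left]
      rcases hk2.eq_or_lt with rfl | hk2
      · rw [height_right hlt']
      · have := (ccwAt_iff_lt (C := C) hrs'' hsn).1 (hup' k hk1 hk2)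
        simp only [node_val] at this
        exact this.le
    have hri' := C.strictMono_fst.monotone hri
    have hjs' := C.strictMono_fst.monotone hjs
    simp only at hlt hri' hjs'
    refine ⟨(p.1, height (C.pt r) (C.pt s) p.1), ⟨r, hr, s, hs, hrs', hrs, ?_⟩, rfl, ?_⟩
    · rw [mem_segment_iff_height hlt']
      exact ⟨by simp only; linarith, by simp only; linarith, rfl⟩
    · simp only
      rw [hp.2.2]
      refine height_le_of_le hlt hp.1 hp.2.1 ?_ ?_
      · rw [height_left]
        exact hle i hri (hij.le.trans hjs)
      · rw [height_right hlt]
        exact hle j (hri.trans hij.le) hjs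

theorem mem_edgesUnder_iff {R : Set (Fin (C.n + 1))} (hR : C.IsRoof R)
    {e : Fin (C.n + 1) × Fin (C.n + 1)} : e ∈ C.edgesUnder R ↔
      ((e.1 : ℕ), (e.2 : ℕ)) ∈ C.upperArcs ∧ ∀ r ∈ R, ¬ (e.1 < r ∧ r < e.2) := by
  constructor
  · rintro ⟨h1, h2, h3⟩
    have h := (liesAbove_segment_iff h1).1 h2
    exact ⟨h, (liesBelow_segment_iff hR h).1 h3⟩
  · rintro ⟨h1, h2⟩
    have hlt : e.1 < e.2 := (mem_upperArcs.1 h1).1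
    exact ⟨hlt, (liesAbove_segment_iff hlt).2 h1, (liesBelow_segment_iff hR h1).2 h2⟩

theorem disjoint_pt_iff {e f : Fin (C.n + 1) × Fin (C.n + 1)}
    (he : ((e.1 : ℕ), (e.2 : ℕ)) ∈ C.upperArcs) (hf : ((f.1 : ℕ), (f.2 : ℕ)) ∈ C.upperArcs)
    (hne : e ≠ f) : Disjoint (openSegment ℝ (C.pt e.1) (C.pt e.2))
      (openSegment ℝ (C.pt f.1) (C.pt f.2)) ↔
      ¬ Interleave ((e.1 : ℕ), (e.2 : ℕ)) ((f.1 : ℕ), (f.2 : ℕ)) := by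
  have := disjoint_iff_not_interleave he hf (fun h => hne (by
    rw [Prod.mk.injEq] at h
    exact Prod.ext (Fin.ext h.1) (Fin.ext h.2)))
  simpa only [node_val] using this

theorem exists_fin_arc {e : ℕ × ℕ} (he : e ∈ C.upperArcs) :
    ∃ f : Fin (C.n + 1) × Fin (C.n + 1), ((f.1 : ℕ), (f.2 : ℕ)) = e := by
  obtain ⟨h1, h2, -⟩ := mem_upperArcs.1 he
  exact ⟨(⟨e.1, by omega⟩, ⟨e.2, by omega⟩), rfl⟩

variable (C) in
/-- A set of arcs, as a set of edges. -/
def arcEdges (U : Finset (ℕ × ℕ)) : Set (Fin (C.n + 1) × Fin (C.n + 1)) :=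
  {e | ((e.1 : ℕ), (e.2 : ℕ)) ∈ U}

variable (C) in
/-- The free vertices of a set of arcs. -/
def freeSet (U : Finset (ℕ × ℕ)) : Set (Fin (C.n + 1)) := {v | Free U v}

/-- Each edge below the roof lies below one roof segment, which is an arc of the dissection;
saturation under that arc gives maximality. -/
theorem isUpperTriangulation_of_isDissection {U : Finset (ℕ × ℕ)}
    (hU : IsDissection C.n C.upperArcs U) :
    C.IsUpperTriangulation (C.freeSet U) (C.arcEdges U) := by
  have hE := C.isArcSet_upperArcs
  have hcons : ∀ i ∈ C.freeSet U, ∀ j ∈ C.freeSet U, i < j →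
      (∀ k ∈ C.freeSet U, ¬ (i < k ∧ k < j)) → ((i : ℕ), (j : ℕ)) ∈ U := by
    intro i hi j hj hij hb
    refine hU.mem_of_consecutive hE ⟨hij, hi, hj, fun v h1 h2 hv => ?_⟩ (by omega)
    exact hb ⟨v, by omega⟩ hv ⟨h1, h2⟩
  have hR : C.IsRoof (C.freeSet U) := ⟨free_zero U, hU.free_last hE,
    fun i hi j hj hij hb => hU.subset (hcons i hi j hj hij hb)⟩
  obtain ⟨h0, hn, habove⟩ := isRoof_iff.1 hR
  refine ⟨h0, hn, habove, ⟨fun e he => ?_, fun e he f hf hne => ?_⟩, ?_⟩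
  · exact (mem_edgesUnder_iff hR).2 ⟨hU.subset he, fun r hr => hr _ he⟩
  · exact (disjoint_pt_iff (hU.subset he) (hU.subset hf) hne).2 (hU.noncrossing _ he _ hf)
  · rintro S ⟨hS, hSn⟩ hUS e he
    have he' := (mem_edgesUnder_iff hR).1 (hS he)
    obtain ⟨r, hr, s, hs, hre, hes, hrs⟩ :=
      hR.exists_segment he'.2
    have hrs' : r < s := hre.trans_lt (lt_of_lt_of_le (mem_upperArcs.1 he'.1).1 hes)
    refine hU.saturated _ he'.1 _ (hcons r hr s hs hrs' hrs) hre hes fun g hg => ?_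
    obtain ⟨g, rfl⟩ := exists_fin_arc (hU.subset hg)
    by_cases heg : e = g
    · subst heg
      rintro (h | h) <;> omega
    · exact (disjoint_pt_iff he'.1 (hU.subset hg) heg).1 (hSn he (hUS hg) heg)

/-- Maximality supplies three kinds of edges: the steps, by uniformity; the roof segments, since
nothing below the roof crosses them; and all arcs required by saturation. -/
theorem exists_isDissection_of_isUpperTriangulation {R : Set (Fin (C.n + 1))}
    {T : Set (Fin (C.n + 1) × Fin (C.n + 1))} (hC : C.Uniform) (h : C.IsUpperTriangulation R T) :
    ∃ U, IsDissection C.n C.upperArcs U ∧ C.freeSet U = R ∧ C.arcEdges U = T := by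
  classical
  have hR : C.IsRoof R := isRoof_iff.2 ⟨h.first_mem, h.last_mem, h.roof_above⟩
  have hE := C.isArcSet_upperArcs
  obtain ⟨⟨hTR, hTn⟩, hmax⟩ := h.maximal
  set U := C.upperArcs.filter fun e => ∃ f ∈ T, ((f.1 : ℕ), (f.2 : ℕ)) = e with hUdef
  have hmem : ∀ e : Fin (C.n + 1) × Fin (C.n + 1), ((e.1 : ℕ), (e.2 : ℕ)) ∈ U ↔ e ∈ T := by
    intro e
    rw [hUdef, Finset.mem_filter]
    constructor
    · rintro ⟨-, f, hf, hfe⟩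
      rw [Prod.mk.injEq] at hfe
      have : f = e := Prod.ext (Fin.ext hfe.1) (Fin.ext hfe.2)
      exact this ▸ hf
    · intro he
      exact ⟨((mem_edgesUnder_iff hR).1 (hTR he)).1, e, he, rfl⟩
  have hUsub : U ⊆ C.upperArcs := Finset.filter_subset _ _
  -- edges under the roof that cross no edge of `T` are in `T`
  have hadd : ∀ e ∈ C.edgesUnder R, (∀ f ∈ T, f ≠ e → Disjoint
      (openSegment ℝ (C.pt e.1) (C.pt e.2)) (openSegment ℝ (C.pt f.1) (C.pt f.2))) → e ∈ T := by
    intro e he hd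
    exact hmax ⟨Set.insert_subset he hTR, nonCrossing_insert hTn hd⟩ (Set.subset_insert e T)
      (Set.mem_insert e T)
  have hU : IsDissection C.n C.upperArcs U := by
    refine ⟨hUsub, fun e he f hf => ?_, fun i hi => ?_, fun e he f hf hfe hef hn => ?_⟩
    · obtain ⟨e, rfl⟩ := exists_fin_arc (hUsub he)
      obtain ⟨f, rfl⟩ := exists_fin_arc (hUsub hf)
      by_cases hef : e = f
      · subst hef
        rintro (h | h) <;> omega
      · exact (disjoint_pt_iff (hUsub he) (hUsub hf) hef).1
          (hTn ((hmem e).1 he) ((hmem f).1 hf) hef)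
    · refine (hmem (⟨i, by omega⟩, ⟨i + 1, by omega⟩)).2 (hadd _ ?_ fun f hf hne => ?_)
      · refine (mem_edgesUnder_iff hR).2 ⟨hE.step i hi, fun r _ hr => ?_⟩
        rw [Fin.lt_def, Fin.lt_def] at hr
        simp only at hr
        omega
      · have hf' := ((mem_edgesUnder_iff hR).1 (hTR hf)).1
        have := disjoint_step (C := C) (m := i) (i := f.1) (j := f.2) hC hi
          (mem_upperArcs.1 hf').1 (by omega) (fun h => hne (by
            rw [Prod.mk.injEq] at h
            exact Prod.ext (Fin.ext h.1) (Fin.ext h.2)))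
        rw [node_val, node_val] at this
        rwa [C.node_eq (i := i) (by omega), C.node_eq (i := i + 1) (by omega)] at this
    · obtain ⟨e, rfl⟩ := exists_fin_arc he
      obtain ⟨f, rfl⟩ := exists_fin_arc (hUsub hf)
      rw [hmem] at hf ⊢
      have hf' := ((mem_edgesUnder_iff hR).1 (hTR hf)).2
      refine hadd e ((mem_edgesUnder_iff hR).2 ⟨he, fun r hr hre => hf' r hr
        ⟨lt_of_le_of_lt hfe hre.1, lt_of_lt_of_le hre.2 hef⟩⟩) fun g hg hne => ?_
      have hg' := (hmem g).2 hg
      exact (disjoint_pt_iff he (hUsub hg') hne.symm).2 (hn _ hg')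
  refine ⟨U, hU, ?_, Set.ext hmem⟩
  ext v
  constructor
  · intro hv
    by_contra hvR
    have hv0 : v ≠ 0 := fun h => hvR (h ▸ hR.first_mem)
    have hvn : v ≠ Fin.last _ := fun h => hvR (h ▸ hR.last_mem)
    have hv0' : (v : ℕ) ≠ 0 := fun h => hv0 (Fin.ext h)
    have hvn' : (v : ℕ) ≠ C.n := fun h => hvn (Fin.ext h)
    -- Only `v` lies strictly between `v - 1` and `v + 1`, so a vertex outside the roof is strictly
    -- inside one roof segment.
    obtain ⟨r, hr, s, hs, hrv, hvs, hrs⟩ := hR.exists_segment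
      (i := ⟨v - 1, by omega⟩) (j := ⟨v + 1, by omega⟩)
      (fun r hr h => hvR (by
        rw [Fin.lt_def, Fin.lt_def] at h
        simp only at h
        have : v = r := Fin.ext (by omega)
        exact this ▸ hr))
    rw [Fin.le_def] at hrv hvs
    simp only at hrv hvs
    -- That segment belongs to `T` by maximality and covers `v`, contradicting freeness.
    have hup := hR.mem_upperArcs r hr s hs (Fin.lt_def.2 (by omega)) hrs
    refine hv (r, s) ((hmem (r, s)).2 (hadd (r, s)
      ((mem_edgesUnder_iff hR).2 ⟨hup, hrs⟩) fun f hf hne => ?_)) ⟨by simp only; omega,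
        by simp only; omega⟩
    have hf' := (mem_edgesUnder_iff hR).1 (hTR hf)
    refine (disjoint_pt_iff hup hf'.1 hne.symm).2 ?_
    have h1 := hf'.2 r hr
    have h2 := hf'.2 s hs
    rw [Fin.lt_def, Fin.lt_def] at h1 h2
    simp only [Interleave]
    omega
  · intro hv e he
    obtain ⟨f, rfl⟩ := exists_fin_arc (hUsub he)
    exact ((mem_edgesUnder_iff hR).1 (hTR ((hmem f).1 he))).2 v hv

theorem ncard_freeSet {U : Finset (ℕ × ℕ)} (hU : IsDissection C.n C.upperArcs U) :
    (C.freeSet U).ncard = freeCount U 0 C.n + 1 := by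
  classical
  have hlast := hU.free_last C.isArcSet_upperArcs
  -- `freeCount` uses the half-open interval and counts segments by their left ends; the last vertex
  -- is the additional roof vertex.
  have himg : (fun v : Fin (C.n + 1) => (v : ℕ)) '' C.freeSet U =
      ((insert C.n ((Finset.Ico 0 C.n).filter (Free U)) : Finset ℕ) : Set ℕ) := by
    ext v
    simp only [Set.mem_image, Finset.coe_insert, Finset.coe_filter, Finset.mem_Ico,
      Set.mem_insert_iff, Set.mem_ofPred_eq]
    constructor
    · rintro ⟨w, hw, rfl⟩
      by_cases h : (w : ℕ) = C.n
      · exact Or.inl h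
      · exact Or.inr ⟨by omega, hw⟩
    · rintro (rfl | ⟨h, hv⟩)
      · exact ⟨Fin.last _, hlast, rfl⟩
      · exact ⟨⟨v, by omega⟩, hv, rfl⟩
  rw [← Set.ncard_image_of_injective _ Fin.val_injective, himg, Set.ncard_coe_finset,
    Finset.card_insert_of_notMem (by simp)]
  rfl

theorem arcEdges_injOn : Set.InjOn (fun U => (C.freeSet U, C.arcEdges U))
    {U | IsDissection C.n C.upperArcs U} := by
  intro U hU V hV h
  have h2 := (Prod.mk.injEq _ _ _ _ ▸ h).2
  have key : ∀ e : Fin (C.n + 1) × Fin (C.n + 1), ((e.1 : ℕ), (e.2 : ℕ)) ∈ U ↔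
      ((e.1 : ℕ), (e.2 : ℕ)) ∈ V := fun e => Set.ext_iff.1 h2 e
  ext e
  constructor
  · intro he
    obtain ⟨f, rfl⟩ := exists_fin_arc (hU.subset he)
    exact (key f).1 he
  · intro he
    obtain ⟨f, rfl⟩ := exists_fin_arc (hV.subset he)
    exact (key f).2 he

/-- The free vertices and the arcs of a dissection give a bijection onto upper triangulations, and
roof length is the number of free vertices before the last. -/
theorem upperCount_eq (hC : C.Uniform) (i : ℕ) : C.upperCount i =
    ((dissections C.n C.upperArcs).filter fun U => freeCount U 0 C.n = i).card := by
  classical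
  have : {RT : Set (Fin (C.n + 1)) × Set (Fin (C.n + 1) × Fin (C.n + 1)) |
      C.IsUpperTriangulation RT.1 RT.2 ∧ RT.1.ncard = i + 1} =
      (fun U => (C.freeSet U, C.arcEdges U)) ''
        (((dissections C.n C.upperArcs).filter fun U => freeCount U 0 C.n = i :
          Finset (Finset (ℕ × ℕ))) : Set (Finset (ℕ × ℕ))) := by
    ext ⟨R, T⟩
    simp only [Set.mem_ofPred_eq, Set.mem_image, Finset.coe_filter, mem_dissections]
    constructor
    · rintro ⟨h, hc⟩
      obtain ⟨U, hU, rfl, rfl⟩ := exists_isDissection_of_isUpperTriangulation hC h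
      rw [ncard_freeSet hU] at hc
      exact ⟨U, ⟨hU, by omega⟩, rfl⟩
    · rintro ⟨U, ⟨hU, hc⟩, hRT⟩
      rw [Prod.mk.injEq] at hRT
      obtain ⟨rfl, rfl⟩ := hRT
      exact ⟨isUpperTriangulation_of_isDissection hU, by rw [ncard_freeSet hU, hc]⟩
  rw [upperCount, this, Set.InjOn.ncard_image, Set.ncard_coe_finset]
  refine arcEdges_injOn.mono fun U hU => ?_
  exact mem_dissections.1 (Finset.mem_filter.1 (Finset.mem_coe.1 hU)).1

end NearEdge

/-! ### The polynomial of a chain, and comparison of order types -/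

theorem freeCount_le (T : Finset (ℕ × ℕ)) (n : ℕ) : freeCount T 0 n ≤ n := by
  classical
  refine (Finset.card_filter_le _ _).trans ?_
  simp

theorem Chain.uniform (C : Chain) : C.toNearEdge.Uniform :=
  NearEdge.isChain_iff_uniform.1 C.isChain

theorem Chain.t_eq (C : Chain) : C.t = dissectionPoly C.n C.upperArcs := by
  classical
  unfold Chain.t dissectionPoly
  -- Group the dissections by roof length, which is at most the number of steps.
  rw [← Finset.sum_fiberwise_of_maps_to (t := Finset.range (C.n + 1))
    (g := fun T => freeCount T 0 C.n)
    (fun T _ => Finset.mem_range.2 (Nat.lt_succ_of_le (freeCount_le T C.n)))]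
  refine Finset.sum_congr rfl fun i _ => ?_
  rw [NearEdge.upperCount_eq C.uniform, Finset.sum_congr rfl (g := fun _ => (X : ℚ[X]) ^ i)
    (fun T hT => by rw [(Finset.mem_filter.1 hT).2]), Finset.sum_const, nsmul_eq_mul]
  simp

/-- Families in general position with the same orientations of increasing triples have the same
order type. -/
theorem sameOrderType_of_increasing {ι : Type*} [LinearOrder ι] {f g : ι → ℝ × ℝ}
    (hf : ∀ i j k, i < j → j < k → orient (f i) (f j) (f k) ≠ 0)
    (hg : ∀ i j k, i < j → j < k → orient (g i) (g j) (g k) ≠ 0)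
    (h : ∀ i j k, i < j → j < k → (Ccw (f i) (f j) (f k) ↔ Ccw (g i) (g j) (g k))) :
    SameOrderType f g := by
  have self₁ : ∀ p q : ℝ × ℝ, orient p p q = 0 := fun p q => by unfold orient; ring
  have self₂ : ∀ p q : ℝ × ℝ, orient p q p = 0 := fun p q => by unfold orient; ring
  have self₃ : ∀ p q : ℝ × ℝ, orient q p p = 0 := fun p q => by unfold orient; ring
  have swap_right : ∀ p q r : ℝ × ℝ, orient p q r = -orient p r q := fun p q r => by
    unfold orient
    ring
  have neg : ∀ i j k, i < j → j < k →
      (0 < -orient (f i) (f j) (f k) ↔ 0 < -orient (g i) (g j) (g k)) := by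
    intro i j k hij hjk
    have h1 := h i j k hij hjk
    rw [ccw_iff, ccw_iff] at h1
    have hf' := hf i j k hij hjk
    have hg' := hg i j k hij hjk
    rw [neg_pos, neg_pos, ← not_le, ← not_le, le_iff_lt_or_eq, le_iff_lt_or_eq, h1,
      or_iff_left hf'.symm, or_iff_left hg'.symm]
  intro i j k
  rw [ccw_iff, ccw_iff]
  rcases lt_trichotomy i j with hij | rfl | hij
  · rcases lt_trichotomy j k with hjk | rfl | hjk
    · exact h i j k hij hjk
    · rw [self₃, self₃]
    · rcases lt_trichotomy i k with hik | rfl | hik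
      · rw [swap_right (f i), swap_right (g i)]
        exact neg i k j hik hjk
      · rw [self₂, self₂]
      · rw [← orient_rotate, ← orient_rotate, ← orient_rotate (g i), ← orient_rotate (g j)]
        exact h k i j hik hij
  · rw [self₁, self₁]
  · rcases lt_trichotomy j k with hjk | rfl | hjk
    · rcases lt_trichotomy i k with hik | rfl | hik
      · rw [orient_swap, orient_swap (g j)]
        exact neg j i k hij hik
      · rw [self₂, self₂]
      · rw [← orient_rotate, ← orient_rotate (g i)]
        exact h j k i hjk hik
    · rw [self₃, self₃]
    · rw [orient_swap, orient_swap (g j), ← orient_rotate, ← orient_rotate, ← orient_rotate (g j),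
        ← orient_rotate (g i)]
      exact neg k j i hjk hij

/-! ### Sums described by order types -/

namespace NearEdge

variable {A B C D : NearEdge}

theorem equiv_iff : C.Equiv D ↔ C.n = D.n ∧
    ∀ i j k, i < j → j < k → k ≤ C.n → (C.CcwAt i j k ↔ D.CcwAt i j k) := by
  have hnode : ∀ h : C.n = D.n, ∀ i : Fin (C.n + 1),
      D.pt (Fin.cast (by rw [h]) i) = D.node i := by
    intro h i
    rw [D.node_eq (by omega)]
    rfl
  constructor
  · rintro ⟨h, H⟩
    refine ⟨h, fun i j k hij hjk hk => ?_⟩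
    have := H ⟨i, by omega⟩ ⟨j, by omega⟩ ⟨k, by omega⟩
    simp only [hnode h] at this
    rwa [← node_val, ← node_val, ← node_val] at this
  · rintro ⟨h, H⟩
    refine ⟨h, sameOrderType_of_increasing (fun i j k hij hjk => ?_) (fun i j k hij hjk => ?_)
      (fun i j k hij hjk => ?_)⟩
    · rw [← node_val, ← node_val, ← node_val]
      exact orient_node_ne_zero hij hjk (by omega)
    · rw [hnode h, hnode h, hnode h]
      exact orient_node_ne_zero hij hjk (by omega)
    · rw [hnode h, hnode h, hnode h, ← node_val, ← node_val, ← node_val]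
      exact H i j k hij hjk (by omega)

/-- The order type of `C` consists of those of `A` and `B`, joined at a common point, where all
the mixed triples are counterclockwise if `s` holds and clockwise otherwise. -/
structure IsOrderSum (s : Prop) (A B C : NearEdge) : Prop where
  n_eq : C.n = A.n + B.n
  left : ∀ i j k, i < j → j < k → k ≤ A.n → (C.CcwAt i j k ↔ A.CcwAt i j k)
  right : ∀ i j k, i < j → j < k → k ≤ B.n →
    (C.CcwAt (i + A.n) (j + A.n) (k + A.n) ↔ B.CcwAt i j k)
  mixed : ∀ i j k, i < j → j < k → k ≤ C.n → i < A.n → A.n < k → (C.CcwAt i j k ↔ s)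

theorem IsOrderSum.right' {s : Prop} (h : IsOrderSum s A B C) {i j k : ℕ} (hi : A.n ≤ i)
    (hij : i < j) (hjk : j < k) (hk : k ≤ C.n) :
    C.CcwAt i j k ↔ B.CcwAt (i - A.n) (j - A.n) (k - A.n) := by
  have hn := h.n_eq
  rw [← h.right (i - A.n) (j - A.n) (k - A.n) (by omega) (by omega) (by omega),
    Nat.sub_add_cancel (by omega), Nat.sub_add_cancel (by omega), Nat.sub_add_cancel (by omega)]

theorem IsOrderSum.equiv {s : Prop} {A' B' C' : NearEdge} (h : IsOrderSum s A B C)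
    (h' : IsOrderSum s A' B' C') (hA : A.Equiv A') (hB : B.Equiv B') : C.Equiv C' := by
  rw [equiv_iff] at hA hB ⊢
  have hn := h.n_eq
  have hn' := h'.n_eq
  refine ⟨by omega, fun i j k hij hjk hk => ?_⟩
  rcases le_or_gt k A.n with h1 | h1
  · rw [h.left i j k hij hjk h1, h'.left i j k hij hjk (by omega), hA.2 i j k hij hjk h1]
  rcases le_or_gt A.n i with h2 | h2
  · rw [h.right' h2 hij hjk hk, h'.right' (by omega) hij hjk (by omega),
      hB.2 _ _ _ (by omega) (by omega) (by omega), hA.1]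
  · rw [h.mixed i j k hij hjk hk h2 h1, h'.mixed i j k hij hjk (by omega) (by omega) (by omega)]

/-- For an edge over the junction both triples in question are mixed, hence have the same
orientation; other edges stay within one summand. -/
theorem IsOrderSum.uniform {s : Prop} (h : IsOrderSum s A B C) (hA : A.Uniform) (hB : B.Uniform) :
    C.Uniform := by
  intro i j k hik hkj hj
  have hn := h.n_eq
  rcases le_or_gt j A.n with h1 | h1
  · rw [h.left i k j hik (by omega) h1, h.left i (k + 1) j (by omega) hkj h1]
    exact hA i j k hik hkj h1
  rcases le_or_gt A.n i with h2 | h2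
  · rw [h.right' h2 hik (by omega) hj, h.right' h2 (by omega) hkj hj,
      show k + 1 - A.n = k - A.n + 1 by omega]
    exact hB _ _ _ (by omega) (by omega) (by omega)
  · rw [h.mixed i k j hik (by omega) hj h2 h1, h.mixed i (k + 1) j (by omega) hkj hj h2 h1]

/-- With a one-point summand there are no mixed triples, so the neutral convention fits the same
description for either orientation. -/
theorem isOrderSum_of_left_eq_zero (s : Prop) (hA : A.n = 0) (h : C.Equiv B) :
    IsOrderSum s A B C := by
  rw [equiv_iff] at h
  refine ⟨by omega, fun i j k _ _ _ => by omega, fun i j k hij hjk hk => ?_,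
    fun i j k _ _ _ _ _ => by omega⟩
  rw [hA]
  exact h.2 i j k hij hjk (by omega)

theorem isOrderSum_of_right_eq_zero (s : Prop) (hB : B.n = 0) (h : C.Equiv A) :
    IsOrderSum s A B C := by
  rw [equiv_iff] at h
  exact ⟨by omega, fun i j k hij hjk hk => h.2 i j k hij hjk (by omega),
    fun i j k _ _ _ => by omega, fun i j k _ _ _ _ _ => by omega⟩

/-- In both bracketings a triple contained in one of the three blocks keeps its orientation, and
every other triple has orientation `s`. -/
theorem IsOrderSum.assoc {s : Prop} {AB BC E F : NearEdge} (h₁ : IsOrderSum s A B AB)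
    (h₂ : IsOrderSum s AB C E) (h₃ : IsOrderSum s B C BC) (h₄ : IsOrderSum s A BC F) :
    E.Equiv F := by
  have n1 := h₁.n_eq
  have n2 := h₂.n_eq
  have n3 := h₃.n_eq
  have n4 := h₄.n_eq
  rw [equiv_iff]
  refine ⟨by omega, fun i j k hij hjk hk => ?_⟩
  rcases le_or_gt k A.n with c1 | c1
  · rw [h₂.left i j k hij hjk (by omega), h₁.left i j k hij hjk c1, h₄.left i j k hij hjk c1]
  rcases le_or_gt AB.n i with c2 | c2
  · rw [h₂.right' c2 hij hjk hk, h₄.right' (by omega) hij hjk (by omega),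
      h₃.right' (by omega) (by omega) (by omega) (by omega), n1]
    simp only [Nat.sub_sub]
  rcases lt_or_ge i A.n with c3 | c3
  · rw [h₄.mixed i j k hij hjk (by omega) c3 c1]
    rcases le_or_gt k AB.n with c4 | c4
    · rw [h₂.left i j k hij hjk c4, h₁.mixed i j k hij hjk c4 c3 c1]
    · rw [h₂.mixed i j k hij hjk hk c2 c4]
  · rw [h₄.right' c3 hij hjk (by omega)]
    rcases le_or_gt k AB.n with c4 | c4
    · rw [h₂.left i j k hij hjk c4, h₁.right' c3 hij hjk c4,
        h₃.left _ _ _ (by omega) (by omega) (by omega)]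
    · rw [h₂.mixed i j k hij hjk hk c2 c4,
        h₃.mixed _ _ _ (by omega) (by omega) (by omega) (by omega) (by omega)]

theorem IsOrderSum.mem_upperArcs_left {s : Prop} (h : IsOrderSum s A B C) (e : ℕ × ℕ)
    (he : e.2 ≤ A.n) : e ∈ C.upperArcs ↔ e ∈ A.upperArcs := by
  have hn := h.n_eq
  rw [mem_upperArcs, mem_upperArcs]
  refine and_congr_right fun _ => and_congr (by omega) (forall₃_congr fun k h1 h2 => ?_)
  exact h.left _ _ _ h1 h2 he

theorem IsOrderSum.mem_upperArcs_right {s : Prop} (h : IsOrderSum s A B C) (e : ℕ × ℕ) :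
    (e.1 + A.n, e.2 + A.n) ∈ C.upperArcs ↔ e ∈ B.upperArcs := by
  have hn := h.n_eq
  rw [mem_upperArcs, mem_upperArcs]
  simp only
  constructor
  · rintro ⟨h1, h2, h3⟩
    refine ⟨by omega, by omega, fun k h4 h5 => ?_⟩
    rw [← h.right _ _ _ h4 h5 (by omega)]
    exact h3 _ (by omega) (by omega)
  · rintro ⟨h1, h2, h3⟩
    refine ⟨by omega, by omega, fun k h4 h5 => ?_⟩
    have := (h.right e.1 (k - A.n) e.2 (by omega) (by omega) (by omega)).2
      (h3 _ (by omega) (by omega))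
    rwa [Nat.sub_add_cancel (by omega)] at this

/-- An arc over the junction would need the junction below it, but that mixed triple is not
counterclockwise. -/
theorem IsOrderSum.dissectionPoly_eq (h : IsOrderSum False A B C) :
    dissectionPoly C.n C.upperArcs =
      dissectionPoly A.n A.upperArcs * dissectionPoly B.n B.upperArcs := by
  have hC := C.isArcSet_upperArcs
  rw [h.n_eq] at hC ⊢
  refine dissectionPoly_mul A.isArcSet_upperArcs B.isArcSet_upperArcs hC h.mem_upperArcs_left
    h.mem_upperArcs_right fun e he h1 => ?_
  rw [mem_upperArcs] at he
  exact (h.mixed _ _ _ h1.1 h1.2 he.2.1 h1.1 h1.2).1 (he.2.2 A.n h1.1 h1.2)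

/-- For an arc over the junction all triples with an intermediate point are mixed and
counterclockwise, so the arc is admitted. -/
theorem IsOrderSum.mapM_dissectionPoly_eq (h : IsOrderSum True A B C) :
    mapM (dissectionPoly C.n C.upperArcs) =
      mapM (dissectionPoly A.n A.upperArcs) * mapM (dissectionPoly B.n B.upperArcs) := by
  have hC := C.isArcSet_upperArcs
  rw [h.n_eq] at hC ⊢
  refine mapM_dissectionPoly_mul A.isArcSet_upperArcs B.isArcSet_upperArcs hC h.mem_upperArcs_left
    h.mem_upperArcs_right fun i j h1 h2 h3 => ?_
  refine mem_upperArcs.2 ⟨h1.trans h2, h.n_eq ▸ h3, fun k h4 h5 => ?_⟩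
  exact (h.mixed _ _ _ h4 h5 (h.n_eq ▸ h3) h1 h2).2 trivial

/-- The near-edge with a single point. -/
def point : NearEdge where
  n := 0
  pt _ := 0
  strictMono_fst := fun i j hij => absurd hij (by omega)
  general i j k hij _ := absurd hij (by omega)

end NearEdge

/-! ### The monoid of chain types and its homomorphisms -/

namespace Chain

open NearEdge

/-- The chain with a single point. -/
def point : Chain where
  toNearEdge := NearEdge.point
  isChain := isChain_iff_uniform.2 fun i j k h1 h2 h3 => by
    have : NearEdge.point.n = 0 := rfl
    omega

theorem type_eq_iff {C D : Chain} : C.type = D.type ↔ C.toNearEdge.Equiv D.toNearEdge :=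
  Quotient.eq (r := Chain.setoid)

theorem type_surjective : Function.Surjective Chain.type := Quotient.mk_surjective

/-- The monoid structure on order types of chains given by a kind of sum. -/
@[reducible]
noncomputable def monoid (s : Prop) (h : ∀ A B : Chain, ∃ C : Chain,
    IsOrderSum s A.toNearEdge B.toNearEdge C.toNearEdge) : Monoid ChainType where
  mul := Quotient.map₂ (fun A B => (h A B).choose) fun A A' hA B B' hB =>
    (h A B).choose_spec.equiv (h A' B').choose_spec hA hB
  one := point.type
  mul_assoc a b c := by
    obtain ⟨A, rfl⟩ := type_surjective a
    obtain ⟨B, rfl⟩ := type_surjective b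
    obtain ⟨C, rfl⟩ := type_surjective c
    exact type_eq_iff.2 ((h A B).choose_spec.assoc (h (h A B).choose C).choose_spec
      (h B C).choose_spec (h A (h B C).choose).choose_spec)
  one_mul a := by
    obtain ⟨A, rfl⟩ := type_surjective a
    exact type_eq_iff.2 ((h point A).choose_spec.equiv
      (isOrderSum_of_left_eq_zero s rfl (NearEdge.Equiv.refl A.toNearEdge)) (NearEdge.Equiv.refl _) (NearEdge.Equiv.refl _))
  mul_one a := by
    obtain ⟨A, rfl⟩ := type_surjective a
    exact type_eq_iff.2 ((h A point).choose_spec.equiv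
      (isOrderSum_of_right_eq_zero s rfl (NearEdge.Equiv.refl A.toNearEdge)) (NearEdge.Equiv.refl _) (NearEdge.Equiv.refl _))

theorem dissectionPoly_of_n_eq_zero {C : NearEdge} (hC : C.n = 0) :
    dissectionPoly C.n C.upperArcs = 1 := by
  have hE : C.upperArcs = ∅ := by
    ext e
    simp only [mem_upperArcs, Finset.notMem_empty, iff_false]
    omega
  have hd : dissections 0 ∅ = {∅} := by
    ext T
    rw [mem_dissections, Finset.mem_singleton]
    constructor
    · exact fun h => Finset.subset_empty.1 h.subset
    · rintro rfl
      exact ⟨subset_rfl, by simp, by simp, by simp⟩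
  rw [hE, hC, dissectionPoly, hd, Finset.sum_singleton, freeCount_self, pow_zero]

/-- Isolates what both kinds of sum share: the geometry enters only through `hsum` and `hex`, the
counting only through `hone` and `hmul`. -/
theorem exists_monoidHom {M : ℝ × ℝ} {s : Prop}
    (hsum : ∀ A B C : NearEdge, IsSum M A B C → IsOrderSum s A B C)
    (hex : ∀ A B : NearEdge, ∃ C : NearEdge, IsSum M A B C) {f : Chain → ℚ[X]}
    (hone : ∀ C : Chain, C.n = 0 → f C = 1)
    (hmul : ∀ A B C : Chain, IsOrderSum s A.toNearEdge B.toNearEdge C.toNearEdge →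
      f C = f A * f B) :
    ∃ (_ : Monoid ChainType) (φ : ChainType →* ℚ[X]),
      (∀ A B : Chain, ∃ C : NearEdge, IsSum M A.toNearEdge B.toNearEdge C) ∧
      (∀ (A B : Chain) (C : NearEdge), IsSum M A.toNearEdge B.toNearEdge C →
        ∃ hC : C.IsChain, A.type * B.type = Chain.type ⟨C, hC⟩) ∧
      (∀ C : Chain, C.n = 0 → C.type = 1) ∧
      (∀ C : Chain, φ C.type = f C) := by
  have hchain : ∀ (A B : Chain) (C : NearEdge), IsOrderSum s A.toNearEdge B.toNearEdge C →
      C.IsChain := fun A B C h => isChain_iff_uniform.2 (h.uniform A.uniform B.uniform)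
  have h : ∀ A B : Chain, ∃ C : Chain, IsOrderSum s A.toNearEdge B.toNearEdge C.toNearEdge := by
    intro A B
    obtain ⟨C, hC⟩ := hex A.toNearEdge B.toNearEdge
    exact ⟨⟨C, hchain A B C (hsum _ _ _ hC)⟩, hsum _ _ _ hC⟩
  have hequiv : ∀ C D : Chain, C.toNearEdge.Equiv D.toNearEdge → f C = f D := by
    intro C D hCD
    -- Invariance under order type comes from multiplicativity: `C` is also a sum of `D` and the
    -- one-point chain.
    rw [hmul D point C (isOrderSum_of_right_eq_zero s rfl hCD), hone point rfl, mul_one]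
  let _ := monoid s h
  refine ⟨monoid s h, ⟨⟨Quotient.lift f hequiv, hone point rfl⟩, ?_⟩, fun A B => hex _ _, ?_, ?_,
    fun C => rfl⟩
  · intro a b
    obtain ⟨A, rfl⟩ := type_surjective a
    obtain ⟨B, rfl⟩ := type_surjective b
    exact hmul A B _ (h A B).choose_spec
  · intro A B C hC
    exact ⟨hchain A B C (hsum _ _ _ hC), type_eq_iff.2 ((h A B).choose_spec.equiv (hsum _ _ _ hC)
      (NearEdge.Equiv.refl _) (NearEdge.Equiv.refl _))⟩
  · intro C hC
    exact type_eq_iff.2 (equiv_iff.2 ⟨hC, fun i j k _ _ _ => by omega⟩)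

end Chain

/-! ### Every glued sum has the prescribed orientations -/

theorem det_prod_eq (L : (ℝ × ℝ) →ₗ[ℝ] (ℝ × ℝ)) :
    LinearMap.det L = (L (1, 0)).1 * (L (0, 1)).2 - (L (0, 1)).1 * (L (1, 0)).2 := by
  rw [← LinearMap.det_toMatrix (Module.Basis.finTwoProd ℝ), Matrix.det_fin_two]
  simp [LinearMap.toMatrix_apply]

theorem map_prod_eq (L : (ℝ × ℝ) →ₗ[ℝ] (ℝ × ℝ)) (u : ℝ × ℝ) :
    L u = u.1 • L (1, 0) + u.2 • L (0, 1) := by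
  rw [← map_smul, ← map_smul, ← map_add]
  congr 1
  ext <;> simp

theorem orient_map (σ : (ℝ × ℝ) →ᵃ[ℝ] (ℝ × ℝ)) (p q r : ℝ × ℝ) :
    orient (σ p) (σ q) (σ r) = LinearMap.det σ.linear * orient p q r := by
  have h : ∀ z, σ z - σ p = (z.1 - p.1) • σ.linear (1, 0) + (z.2 - p.2) • σ.linear (0, 1) := by
    intro z
    have := σ.linearMap_vsub z p
    rw [vsub_eq_sub, vsub_eq_sub, map_prod_eq] at this
    exact this.symm
  have hq1 := congrArg Prod.fst (h q)
  have hq2 := congrArg Prod.snd (h q)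
  have hr1 := congrArg Prod.fst (h r)
  have hr2 := congrArg Prod.snd (h r)
  simp only [Prod.fst_sub, Prod.snd_sub, Prod.fst_add, Prod.snd_add, Prod.smul_fst, Prod.smul_snd,
    smul_eq_mul] at hq1 hq2 hr1 hr2
  rw [det_prod_eq]
  unfold orient
  rw [hq1, hq2, hr1, hr2]
  ring

theorem ccw_map {σ : (ℝ × ℝ) →ᵃ[ℝ] (ℝ × ℝ)} (h : 0 < LinearMap.det σ.linear) (p q r : ℝ × ℝ) :
    Ccw (σ p) (σ q) (σ r) ↔ Ccw p q r := by
  rw [ccw_iff, ccw_iff, orient_map]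
  exact mul_pos_iff_of_pos_left h

theorem continuous_shrink (a b p : ℝ × ℝ) : Continuous fun ε : ℝ => shrink ε a b p := by
  unfold shrink
  fun_prop

theorem continuous_orient : Continuous fun x : (ℝ × ℝ) × (ℝ × ℝ) × (ℝ × ℝ) =>
    orient x.1 x.2.1 x.2.2 := by
  unfold orient
  fun_prop

namespace IsNearEdgeOf

variable {k : ℕ} {ι : Type*} {a : Fin (k + 1) → ℝ × ℝ} {b : ι → ℝ × ℝ}

/-- Orientations of triples that are non-degenerate after projecting the near-edge to its line are
already present before. -/
theorem ccw_of_foot (h : IsNearEdgeOf a b) {x y z : Fin (k + 1) ⊕ ι}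
    (hxyz : Ccw (Sum.elim (fun i => foot (a 0) (a (Fin.last k)) (a i)) b x)
      (Sum.elim (fun i => foot (a 0) (a (Fin.last k)) (a i)) b y)
      (Sum.elim (fun i => foot (a 0) (a (Fin.last k)) (a i)) b z)) :
    Ccw (Sum.elim a b x) (Sum.elim a b y) (Sum.elim a b z) := by
  set g : ℝ → Fin (k + 1) ⊕ ι → ℝ × ℝ := fun ε =>
    Sum.elim (fun i => shrink ε (a 0) (a (Fin.last k)) (a i)) b with hg
  have hcont : ∀ w, Continuous fun ε => g ε w := by
    rintro (i | j)
    · exact continuous_shrink _ _ _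
    · exact continuous_const
  have h0 : ∀ w, g 0 w = Sum.elim (fun i => foot (a 0) (a (Fin.last k)) (a i)) b w := by
    rintro (i | j)
    · simp [hg, shrink]
    · rfl
  have hc : Continuous fun ε => orient (g ε x) (g ε y) (g ε z) :=
    continuous_orient.comp ((hcont x).prodMk ((hcont y).prodMk (hcont z)))
  have hev : ∀ᶠ ε in nhds (0 : ℝ), 0 < orient (g ε x) (g ε y) (g ε z) := by
    refine hc.continuousAt.eventually (lt_mem_nhds ?_)
    simp only [h0]
    exact hxyz
  -- Positive orientation is an open condition, so it survives for some small positive `ε`; the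
  -- near-edge condition transfers it to the original points.
  obtain ⟨ε, hε, hε0, hε1⟩ := ((hev.filter_mono nhdsWithin_le_nhds).and
    (Ioc_mem_nhdsGT (zero_lt_one' ℝ))).exists
  exact (h.2.2 ε hε0 hε1 x y z).2 hε

theorem orient_of_foot (h : IsNearEdgeOf a b) (x y z : Fin (k + 1) ⊕ ι) {κ : ℝ}
    (hxyz : 0 < κ * orient (Sum.elim (fun i => foot (a 0) (a (Fin.last k)) (a i)) b x)
      (Sum.elim (fun i => foot (a 0) (a (Fin.last k)) (a i)) b y)
      (Sum.elim (fun i => foot (a 0) (a (Fin.last k)) (a i)) b z)) :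
    0 < κ * orient (Sum.elim a b x) (Sum.elim a b y) (Sum.elim a b z) := by
  rcases pos_and_pos_or_neg_and_neg_of_mul_pos hxyz with ⟨h1, h2⟩ | ⟨h1, h2⟩
  · exact mul_pos h1 (h.ccw_of_foot h2)
  · rw [← neg_pos, ← orient_swap] at h2
    have := h.ccw_of_foot h2
    rw [ccw_iff, orient_swap, neg_pos] at this
    exact mul_pos_of_neg_of_neg h1 this

/-- The position of the projections on the line, from `0` to `1`. -/
theorem exists_foot_eq (h : IsNearEdgeOf a b) (hne : a 0 ≠ a (Fin.last k)) :
    ∃ t : Fin (k + 1) → ℝ, StrictMono t ∧ t 0 = 0 ∧ t (Fin.last k) = 1 ∧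
      ∀ i, foot (a 0) (a (Fin.last k)) (a i) = a 0 + t i • (a (Fin.last k) - a 0) := by
  set d := a (Fin.last k) - a 0 with hd
  have hD : 0 < dot d d := by
    have : d.1 ≠ 0 ∨ d.2 ≠ 0 := by
      by_contra hcon
      push Not at hcon
      exact hne (sub_eq_zero.1 (Prod.ext hcon.1 hcon.2)).symm
    unfold dot
    rcases this with h | h
    · nlinarith [mul_self_pos.2 h, mul_self_nonneg d.2]
    · nlinarith [mul_self_pos.2 h, mul_self_nonneg d.1]
  refine ⟨fun i => dot (a i - a 0) d / dot d d, fun i j hij => ?_, ?_, ?_, fun i => rfl⟩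
  · exact div_lt_div_of_pos_right (h.2.1 hij) hD
  · simp [dot]
  · exact div_self hD.ne'

end IsNearEdgeOf

namespace NearEdge

variable {A B C : NearEdge}

/-- The pieces are collapsed one at a time. Collapsing one piece and keeping the opposite end of the
triangle gives the orientation of the other side with each point of that piece; collapsing the other
piece then handles all mixed triples. The factor `-μ` treats both signs together. -/
theorem IsGluedSum.isOrderSum {μ : ℝ} (hμ : μ ≠ 0) (h : IsGluedSum (1, μ) A B C) :
    IsOrderSum (μ < 0) A B C := by
  obtain ⟨σ, τ, hσ, hτ, hσ0, hσ1, hτ0, hτ1, hA, hB, hn, hCA, hCB⟩ := h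
  have hAn : 0 < A.n := hA.1
  have hBn : 0 < B.n := hB.1
  have hμ2 : 0 < μ * μ := mul_self_pos.2 hμ
  obtain ⟨t, ht, ht0, ht1, hft⟩ := hA.exists_foot_eq (by
    simp only [hσ0, hσ1]
    intro h
    exact absurd (congrArg Prod.fst h) (by norm_num))
  obtain ⟨u, hu, hu0, hu1, hfu⟩ := hB.exists_foot_eq (by
    simp only [hτ0, hτ1]
    intro h
    exact absurd (congrArg Prod.fst h) (by norm_num))
  have hfl : foot (σ (A.pt 0)) (σ (A.pt (Fin.last A.n))) (σ (A.pt (Fin.last A.n))) = (1, μ) := by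
    rw [hft, ht1, one_smul, add_sub_cancel, hσ1]
  have hf0 : foot (τ (B.pt 0)) (τ (B.pt (Fin.last B.n))) (τ (B.pt 0)) = (1, μ) := by
    rw [hfu, hu0, zero_smul, add_zero, hτ0]
  have tlt : ∀ i : Fin (A.n + 1), (i : ℕ) < A.n → t i < 1 := fun i hi => by
    rw [← ht1]
    exact ht (Fin.lt_def.2 hi)
  have upos : ∀ j : Fin (B.n + 1), 0 < (j : ℕ) → 0 < u j := fun j hj => by
    rw [← hu0]
    exact hu (Fin.lt_def.2 hj)
  -- the base triangles
  have baseB : ∀ l : Fin (B.n + 1), 0 < (l : ℕ) → 0 < -μ * orient (0, 0) (1, μ) (τ (B.pt l)) := by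
    intro l hl
    have := hB.orient_of_foot (Sum.inr (⟨0, hAn⟩ : Fin A.n)) (Sum.inl 0) (Sum.inl l) (κ := -μ) (by
      simp only [Sum.elim_inl, Sum.elim_inr]
      rw [hf0, hfu, hτ0, hτ1]
      have hl' := upos l hl
      have : A.pt (Fin.castSucc ⟨0, hAn⟩) = A.pt 0 := rfl
      rw [this, hσ0]
      simp only [orient, Prod.fst_add, Prod.snd_add, Prod.smul_fst, Prod.smul_snd, Prod.fst_sub,
        Prod.snd_sub, smul_eq_mul]
      have := mul_pos hμ2 hl'
      linarith)
    simp only [Sum.elim_inl, Sum.elim_inr, hτ0] at this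
    have h0 : A.pt (Fin.castSucc ⟨0, hAn⟩) = A.pt 0 := rfl
    rwa [h0, hσ0] at this
  have baseA : ∀ i : Fin (A.n + 1), (i : ℕ) < A.n →
      0 < -μ * orient (σ (A.pt i)) (1, μ) (2, 0) := by
    intro i hi
    have hlast : (⟨B.n - 1, by omega⟩ : Fin B.n).succ = Fin.last B.n :=
      Fin.ext (by simp only [Fin.succ_mk, Fin.val_last]; omega)
    have := hA.orient_of_foot (Sum.inl i) (Sum.inl (Fin.last A.n))
      (Sum.inr (⟨B.n - 1, by omega⟩ : Fin B.n)) (κ := -μ) (by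
      simp only [Sum.elim_inl, Sum.elim_inr]
      rw [hfl, hft, hσ0, hσ1, hlast, hτ1]
      have hi' := tlt i hi
      simp only [orient, Prod.fst_add, Prod.snd_add, Prod.smul_fst, Prod.smul_snd, Prod.fst_sub,
        Prod.snd_sub, smul_eq_mul]
      have := mul_pos hμ2 (sub_pos.2 hi')
      linarith)
    simp only [Sum.elim_inl, Sum.elim_inr, hσ1, hlast, hτ1] at this
    exact this
  have mixA : ∀ i j : Fin (A.n + 1), ∀ l : Fin (B.n + 1), i < j → 0 < (l : ℕ) →
      0 < -μ * orient (σ (A.pt i)) (σ (A.pt j)) (τ (B.pt l)) := by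
    intro i j l hij hl
    have hsucc : (⟨l - 1, by omega⟩ : Fin B.n).succ = l :=
      Fin.ext (by simp only [Fin.succ_mk]; omega)
    have := hA.orient_of_foot (Sum.inl i) (Sum.inl j)
      (Sum.inr (⟨l - 1, by omega⟩ : Fin B.n)) (κ := -μ) (by
      simp only [Sum.elim_inl, Sum.elim_inr]
      rw [hft, hft, hσ0, hσ1, hsucc]
      -- With the first piece on its side, the triple is the triangle on the whole side scaled by `t
      -- j - t i`.
      have := mul_pos (sub_pos.2 (ht hij)) (baseB l hl)
      simp only [orient, Prod.fst_add, Prod.snd_add, Prod.smul_fst, Prod.smul_snd, Prod.fst_sub,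
        Prod.snd_sub, smul_eq_mul] at this ⊢
      linarith)
    simp only [Sum.elim_inl, Sum.elim_inr, hsucc] at this
    exact this
  have mixB : ∀ i : Fin (A.n + 1), ∀ j l : Fin (B.n + 1), (i : ℕ) < A.n → j < l →
      0 < -μ * orient (σ (A.pt i)) (τ (B.pt j)) (τ (B.pt l)) := by
    intro i j l hi hjl
    have hcast : (⟨i, hi⟩ : Fin A.n).castSucc = i := rfl
    have := hB.orient_of_foot (Sum.inr (⟨i, hi⟩ : Fin A.n)) (Sum.inl j) (Sum.inl l) (κ := -μ) (by
      simp only [Sum.elim_inl, Sum.elim_inr]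
      rw [hfu, hfu, hτ0, hτ1, hcast]
      have := mul_pos (sub_pos.2 (hu hjl)) (baseA i hi)
      simp only [orient, Prod.fst_add, Prod.snd_add, Prod.smul_fst, Prod.smul_snd, Prod.fst_sub,
        Prod.snd_sub, smul_eq_mul] at this ⊢
      linarith)
    simp only [Sum.elim_inl, Sum.elim_inr, hcast] at this
    exact this
  have sign : ∀ {p q r : ℝ × ℝ}, 0 < -μ * orient p q r → (Ccw p q r ↔ μ < 0) := by
    intro p q r h
    rw [ccw_iff]
    constructor <;> intro h' <;> nlinarith
  have nodeA : ∀ i, (hi : i ≤ A.n) → C.node i = σ (A.pt ⟨i, by omega⟩) := fun i hi => by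
    rw [C.node_eq (by omega), ← hCA]
  have nodeB : ∀ j, (hj : j ≤ B.n) → C.node (A.n + j) = τ (B.pt ⟨j, by omega⟩) := fun j hj => by
    rw [C.node_eq (by omega), ← hCB]
  refine ⟨hn, fun i j k hij hjk hk => ?_, fun i j k hij hjk hk => ?_,
    fun i j k hij hjk hk hi hk' => ?_⟩
  · unfold CcwAt
    rw [nodeA i (by omega), nodeA j (by omega), nodeA k hk, ccw_map hσ, A.node_eq, A.node_eq,
      A.node_eq]
  · unfold CcwAt
    rw [add_comm i, add_comm j, add_comm k, nodeB i (by omega), nodeB j (by omega), nodeB k hk,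
      ccw_map hτ, B.node_eq, B.node_eq, B.node_eq]
  · unfold CcwAt
    obtain ⟨l, rfl⟩ : ∃ l, k = A.n + l := ⟨k - A.n, by omega⟩
    rcases le_or_gt j A.n with hj | hj
    · rw [nodeA i hi.le, nodeA j hj, nodeB l (by omega)]
      exact sign (mixA _ _ _ (Fin.mk_lt_mk.2 hij) (by simp only; omega))
    · obtain ⟨m, rfl⟩ : ∃ m, j = A.n + m := ⟨j - A.n, by omega⟩
      rw [nodeA i hi.le, nodeB m (by omega), nodeB l (by omega)]
      exact sign (mixB _ _ _ hi (Fin.mk_lt_mk.2 (by omega)))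

theorem IsSum.isOrderSum {μ : ℝ} (hμ : μ ≠ 0) (h : IsSum (1, μ) A B C) :
    IsOrderSum (μ < 0) A B C := by
  rcases h with ⟨hA, h⟩ | ⟨hB, h⟩ | h
  · exact isOrderSum_of_left_eq_zero _ hA h
  · exact isOrderSum_of_right_eq_zero _ hB h
  · exact h.isOrderSum hμ

end NearEdge

/-! ### Existence of sums: gluing flat copies -/

section Join

variable {a b : ℕ}

/-- The concatenation of two families with a common point. -/
def joinPts (α : Fin (a + 1) → ℝ × ℝ) (β : Fin (b + 1) → ℝ × ℝ) : Fin (a + b + 1) → ℝ × ℝ :=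
  fun k => if h : (k : ℕ) ≤ a then α ⟨k, by omega⟩ else β ⟨k - a, by omega⟩

theorem joinPts_of_le (α : Fin (a + 1) → ℝ × ℝ) (β : Fin (b + 1) → ℝ × ℝ) {k : Fin (a + b + 1)}
    (h : (k : ℕ) ≤ a) : joinPts α β k = α ⟨k, by omega⟩ := dif_pos h

theorem joinPts_of_ge {α : Fin (a + 1) → ℝ × ℝ} {β : Fin (b + 1) → ℝ × ℝ}
    (hαβ : α (Fin.last a) = β 0) {k : Fin (a + b + 1)} (h : a ≤ (k : ℕ)) :
    joinPts α β k = β ⟨k - a, by omega⟩ := by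
  rcases h.eq_or_lt with h' | h'
  · have e1 : (⟨k, by omega⟩ : Fin (a + 1)) = Fin.last a := Fin.ext h'.symm
    have e2 : (⟨k - a, by omega⟩ : Fin (b + 1)) = 0 := Fin.ext (by simp only [Fin.val_zero]; omega)
    rw [joinPts_of_le α β h'.ge, e1, e2, hαβ]
  · exact dif_neg (by omega)

/-- Two families in general position with a common point such that all mixed triples have the
orientation given by the sign of `κ`. -/
structure IsJoinable (κ : ℝ) (α : Fin (a + 1) → ℝ × ℝ) (β : Fin (b + 1) → ℝ × ℝ) : Prop where
  glue : α (Fin.last a) = β 0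
  general_left : ∀ i j k, i < j → j < k → orient (α i) (α j) (α k) ≠ 0
  general_right : ∀ i j k, i < j → j < k → orient (β i) (β j) (β k) ≠ 0
  mixed_left : ∀ i j l, i < j → 0 < l → 0 < κ * orient (α i) (α j) (β l)
  mixed_right : ∀ i j l, i < Fin.last a → j < l → 0 < κ * orient (α i) (β j) (β l)

namespace IsJoinable

variable {κ : ℝ} {α α' : Fin (a + 1) → ℝ × ℝ} {β β' : Fin (b + 1) → ℝ × ℝ}

theorem mixed (h : IsJoinable κ α β) {i j k : Fin (a + b + 1)} (hij : i < j) (hjk : j < k)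
    (hi : (i : ℕ) < a) (hk : a < (k : ℕ)) :
    0 < κ * orient (joinPts α β i) (joinPts α β j) (joinPts α β k) := by
  rw [Fin.lt_def] at hij hjk
  rw [joinPts_of_le α β hi.le, joinPts_of_ge h.glue hk.le]
  rcases le_total (j : ℕ) a with hj | hj
  · rw [joinPts_of_le α β hj]
    exact h.mixed_left _ _ _ (Fin.mk_lt_mk.2 hij)
      (Fin.lt_def.2 (by simp only [Fin.val_zero]; omega))
  · rw [joinPts_of_ge h.glue hj]
    exact h.mixed_right _ _ _ (Fin.lt_def.2 hi) (Fin.mk_lt_mk.2 (by omega))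

theorem general (h : IsJoinable κ α β) (i j k : Fin (a + b + 1)) (hij : i < j) (hjk : j < k) :
    orient (joinPts α β i) (joinPts α β j) (joinPts α β k) ≠ 0 := by
  have hij' := Fin.lt_def.1 hij
  have hjk' := Fin.lt_def.1 hjk
  rcases le_or_gt (k : ℕ) a with hk | hk
  · rw [joinPts_of_le α β (by omega), joinPts_of_le α β (by omega), joinPts_of_le α β hk]
    exact h.general_left _ _ _ (Fin.mk_lt_mk.2 hij) (Fin.mk_lt_mk.2 hjk)
  rcases le_or_gt a (i : ℕ) with hi | hi
  · rw [joinPts_of_ge h.glue hi, joinPts_of_ge h.glue (by omega), joinPts_of_ge h.glue (by omega)]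
    exact h.general_right _ _ _ (Fin.mk_lt_mk.2 (by omega)) (Fin.mk_lt_mk.2 (by omega))
  · exact fun h0 => (h.mixed hij hjk hi hk).ne' (by rw [h0, mul_zero])

theorem sameOrderType (h : IsJoinable κ α β) (h' : IsJoinable κ α' β')
    (hα : ∀ i j k, Ccw (α i) (α j) (α k) ↔ Ccw (α' i) (α' j) (α' k))
    (hβ : ∀ i j k, Ccw (β i) (β j) (β k) ↔ Ccw (β' i) (β' j) (β' k)) :
    SameOrderType (joinPts α β) (joinPts α' β') := by
  refine sameOrderType_of_increasing h.general h'.general fun i j k hij hjk => ?_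
  have hij' := Fin.lt_def.1 hij
  have hjk' := Fin.lt_def.1 hjk
  rcases le_or_gt (k : ℕ) a with hk | hk
  · simp only [joinPts_of_le α β hk, joinPts_of_le α β (show (i : ℕ) ≤ a by omega),
      joinPts_of_le α β (show (j : ℕ) ≤ a by omega), joinPts_of_le α' β' hk,
      joinPts_of_le α' β' (show (i : ℕ) ≤ a by omega),
      joinPts_of_le α' β' (show (j : ℕ) ≤ a by omega)]
    exact hα _ _ _
  rcases le_or_gt a (i : ℕ) with hi | hi
  · simp only [joinPts_of_ge h.glue hi, joinPts_of_ge h.glue (show a ≤ (j : ℕ) by omega),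
      joinPts_of_ge h.glue (show a ≤ (k : ℕ) by omega), joinPts_of_ge h'.glue hi,
      joinPts_of_ge h'.glue (show a ≤ (j : ℕ) by omega),
      joinPts_of_ge h'.glue (show a ≤ (k : ℕ) by omega)]
    exact hβ _ _ _
  · have m1 := h.mixed hij hjk hi hk
    have m2 := h'.mixed hij hjk hi hk
    rw [ccw_iff, ccw_iff]
    constructor
    · exact fun h0 => (mul_pos_iff_of_pos_left ((pos_iff_pos_of_mul_pos m1).2 h0)).1 m2
    · exact fun h0 => (mul_pos_iff_of_pos_left ((pos_iff_pos_of_mul_pos m2).2 h0)).1 m1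

end IsJoinable

theorem SameOrderType.comp {ι ι' : Type*} {f g : ι → ℝ × ℝ} (h : SameOrderType f g) (e : ι' → ι) :
    SameOrderType (f ∘ e) (g ∘ e) := fun i j k => h (e i) (e j) (e k)

/-- Writes the family of the near-edge condition as a reindexing of the joined family, so that one
comparison of order types serves both pieces. -/
theorem sumElim_left_eq {α : Fin (a + 1) → ℝ × ℝ} {β : Fin (b + 1) → ℝ × ℝ}
    (hαβ : α (Fin.last a) = β 0) : Sum.elim α (fun j : Fin b => β j.succ) =
      joinPts α β ∘ Sum.elim (fun i : Fin (a + 1) => ⟨i, by omega⟩)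
        (fun j : Fin b => ⟨a + (j + 1), by omega⟩) := by
  ext1 x
  rcases x with i | j
  · exact (joinPts_of_le α β (k := ⟨i, by omega⟩) (Nat.lt_succ_iff.1 i.2)).symm
  · simp only [Sum.elim_inr, Function.comp]
    rw [joinPts_of_ge hαβ (k := ⟨a + (j + 1), by omega⟩) (Nat.le_add_right _ _)]
    congr 1
    ext
    simp

theorem sumElim_right_eq {α : Fin (a + 1) → ℝ × ℝ} {β : Fin (b + 1) → ℝ × ℝ}
    (hαβ : α (Fin.last a) = β 0) : Sum.elim β (fun i : Fin a => α i.castSucc) =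
      joinPts α β ∘ Sum.elim (fun j : Fin (b + 1) => ⟨a + j, by omega⟩)
        (fun i : Fin a => ⟨i, by omega⟩) := by
  ext1 x
  rcases x with j | i
  · simp only [Sum.elim_inl, Function.comp]
    rw [joinPts_of_ge hαβ (k := ⟨a + j, by omega⟩) (Nat.le_add_right _ _)]
    congr 1
    ext
    simp
  · exact (joinPts_of_le α β (k := ⟨i, by omega⟩) i.2.le).symm

end Join

/-- The point at abscissa `p.1 + t` and vertical distance `c` over the line through `p` of slope `m`,
shrunk by the factor `ε` towards this line. -/
noncomputable def flatPt (p : ℝ × ℝ) (m ε t c : ℝ) : ℝ × ℝ :=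
  (p.1 + t + (1 - ε) * (m * c / (1 + m ^ 2)),
    p.2 + m * t + c * (ε + (1 - ε) * (m ^ 2 / (1 + m ^ 2))))

theorem flatPt_one (p : ℝ × ℝ) (m t c : ℝ) : flatPt p m 1 t c = (p.1 + t, p.2 + m * t + c) := by
  simp [flatPt]

theorem flatPt_zero (p : ℝ × ℝ) (m ε t : ℝ) : flatPt p m ε t 0 = (p.1 + t, p.2 + m * t) := by
  simp [flatPt]

theorem shrink_flatPt (p : ℝ × ℝ) (m ε t c : ℝ) :
    shrink ε p (p.1 + 1, p.2 + m) (flatPt p m 1 t c) = flatPt p m ε t c := by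
  have h : (1 : ℝ) + m ^ 2 ≠ 0 := by positivity
  have h' : dot ((p.1 + 1, p.2 + m) - p) ((p.1 + 1, p.2 + m) - p) = 1 + m ^ 2 := by
    simp only [dot, Prod.fst_sub, Prod.snd_sub]
    ring
  rw [flatPt_one, shrink, foot, h']
  unfold flatPt dot
  apply Prod.ext
  · simp only [Prod.fst_add, Prod.fst_sub, Prod.snd_sub, Prod.smul_fst, smul_eq_mul]
    field_simp
    ring
  · simp only [Prod.snd_add, Prod.fst_sub, Prod.snd_sub, Prod.smul_snd, smul_eq_mul]
    field_simp
    ring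

/-- Shrinking by `ε` towards a line is an affine map of determinant `ε`. -/
theorem orient_flatPt (p : ℝ × ℝ) (m ε t c t' c' t'' c'' : ℝ) :
    orient (flatPt p m ε t c) (flatPt p m ε t' c') (flatPt p m ε t'' c'') =
      ε * orient (flatPt p m 1 t c) (flatPt p m 1 t' c') (flatPt p m 1 t'' c'') := by
  have h : (1 : ℝ) + m ^ 2 ≠ 0 := by positivity
  simp only [flatPt_one]
  unfold flatPt orient
  field_simp
  ring

/-- A near-edge can be moved near to a segment of slope `m` and width one. -/
theorem NearEdge.exists_placement (A : NearEdge) (hA : 0 < A.n) (p : ℝ × ℝ) (m : ℝ) :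
    ∃ t h : Fin (A.n + 1) → ℝ, StrictMono t ∧ t 0 = 0 ∧ t (Fin.last A.n) = 1 ∧ h 0 = 0 ∧
      h (Fin.last A.n) = 0 ∧ ∀ δ : ℝ, 0 < δ → ∃ σ : (ℝ × ℝ) →ᵃ[ℝ] (ℝ × ℝ),
        0 < LinearMap.det σ.linear ∧ ∀ i, σ (A.pt i) = flatPt p m 1 (t i) (δ * h i) := by
  set o := A.pt 0 with ho
  set w := (A.pt (Fin.last A.n)).1 - o.1 with hw
  set s := ((A.pt (Fin.last A.n)).2 - o.2) / w with hs
  have hw0 : 0 < w := sub_pos.2 (A.strictMono_fst (Fin.lt_def.2 hA))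
  refine ⟨fun i => ((A.pt i).1 - o.1) / w, fun i => (A.pt i).2 - o.2 - s * ((A.pt i).1 - o.1),
    fun i j hij => ?_, by simp [ho], ?_, by simp [ho], ?_, fun δ hδ => ?_⟩
  · exact div_lt_div_of_pos_right (sub_lt_sub_right (A.strictMono_fst hij) _) hw0
  · exact div_self hw0.ne'
  · simp only
    rw [← hw, hs, div_mul_cancel₀ _ hw0.ne', sub_self]
  -- Scale the chord to width one, give it slope `m`, and multiply vertical heights over it by `δ`.
  -- The determinant is `δ / w`, and `t`, `h` do not depend on `δ`.
  · let L : (ℝ × ℝ) →ₗ[ℝ] (ℝ × ℝ) :=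
      { toFun := fun u => (u.1 / w, m * (u.1 / w) + δ * (u.2 - s * u.1))
        map_add' := fun u v => by
          apply Prod.ext <;> simp only [Prod.fst_add, Prod.snd_add] <;> ring
        map_smul' := fun c u => by
          apply Prod.ext <;> simp only [Prod.smul_fst, Prod.smul_snd, smul_eq_mul,
            RingHom.id_apply] <;> ring }
    have hL : ∀ u, L u = (u.1 / w, m * (u.1 / w) + δ * (u.2 - s * u.1)) := fun u => rfl
    refine ⟨⟨fun z => L (z - o) + p, L, fun z v => ?_⟩, ?_, fun i => ?_⟩
    · rw [vadd_eq_add, vadd_eq_add, add_sub_assoc, map_add, add_assoc]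
    · rw [det_prod_eq, hL, hL]
      simp only
      have : 0 < δ / w := by positivity
      simp only [zero_div, mul_zero, sub_zero, zero_mul]
      rw [mul_one, zero_add, one_div, mul_comm]
      exact this
    · rw [flatPt_one]
      change L (A.pt i - o) + p = _
      rw [hL]
      apply Prod.ext <;> simp only [Prod.fst_add, Prod.snd_add, Prod.fst_sub, Prod.snd_sub] <;> ring

/-- Positivity on a compact square of parameters persists under small perturbations. -/
theorem eventually_forall_pos {F : ℝ × ℝ × ℝ → ℝ} (hF : Continuous F) (h : ∀ e, 0 < F (0, e)) :
    ∀ᶠ δ in nhds (0 : ℝ), ∀ e ∈ Set.Icc (0 : ℝ) 1 ×ˢ Set.Icc (0 : ℝ) 1, 0 < F (δ, e) :=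
  (isCompact_Icc.prod isCompact_Icc).eventually_forall_of_forall_eventually
    (P := fun δ e => 0 < F (δ, e)) fun e _ => hF.continuousAt.eventually (lt_mem_nhds (h e))

theorem continuous_flatPt (p : ℝ × ℝ) (m t h : ℝ) :
    Continuous fun x : ℝ × ℝ => flatPt p m x.2 t (x.1 * h) := by
  unfold flatPt
  fun_prop

/-- For small `δ`, flattened pieces over the sides of the triangle are joinable. -/
theorem eventually_mixed {a b : ℕ} {μ : ℝ} (hμ : μ ≠ 0) {t h : Fin (a + 1) → ℝ}
    {u g : Fin (b + 1) → ℝ} (ht : StrictMono t) (ht1 : t (Fin.last a) = 1) (hu : StrictMono u)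
    (hu0 : u 0 = 0) :
    ∀ᶠ δ in nhds (0 : ℝ), ∀ e ∈ Set.Icc (0 : ℝ) 1 ×ˢ Set.Icc (0 : ℝ) 1,
      (∀ i j l, i < j → 0 < l → 0 < -μ * orient (flatPt (0, 0) μ e.1 (t i) (δ * h i))
        (flatPt (0, 0) μ e.1 (t j) (δ * h j)) (flatPt (1, μ) (-μ) e.2 (u l) (δ * g l))) ∧
      (∀ i j l, i < Fin.last a → j < l → 0 < -μ * orient (flatPt (0, 0) μ e.1 (t i) (δ * h i))
        (flatPt (1, μ) (-μ) e.2 (u j) (δ * g j)) (flatPt (1, μ) (-μ) e.2 (u l) (δ * g l))) := by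
  have hμ2 : 0 < μ * μ := mul_self_pos.2 hμ
  have cont₁ : ∀ i, Continuous fun x : ℝ × ℝ × ℝ => flatPt (0, 0) μ x.2.1 (t i) (x.1 * h i) :=
    fun i => (continuous_flatPt (0, 0) μ (t i) (h i)).comp
      (continuous_fst.prodMk continuous_snd.fst)
  have cont₂ : ∀ j, Continuous fun x : ℝ × ℝ × ℝ =>
      flatPt (1, μ) (-μ) x.2.2 (u j) (x.1 * g j) :=
    fun i => (continuous_flatPt (1, μ) (-μ) (u i) (g i)).comp
      (continuous_fst.prodMk continuous_snd.snd)
  have H₁ : ∀ i j l, ∀ᶠ δ in nhds (0 : ℝ), i < j → 0 < l →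
      ∀ e ∈ Set.Icc (0 : ℝ) 1 ×ˢ Set.Icc (0 : ℝ) 1,
      0 < -μ * orient (flatPt (0, 0) μ e.1 (t i) (δ * h i))
        (flatPt (0, 0) μ e.1 (t j) (δ * h j)) (flatPt (1, μ) (-μ) e.2 (u l) (δ * g l)) := by
    intro i j l
    by_cases hij : i < j
    · by_cases hl : 0 < l
      · refine (eventually_forall_pos (F := fun x => -μ * orient _ _ _) (continuous_const.mul
          (continuous_orient.comp ((cont₁ i).prodMk ((cont₁ j).prodMk (cont₂ l)))))
          fun e => ?_).mono fun δ hδ _ _ => hδ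
        -- At `δ = 0` the points are on the sides of the triangle whatever the shrinking factors,
        -- and the quantity is `2 * μ ^ 2 * (t j - t i) * u l`.
        simp only [zero_mul, flatPt_zero, orient]
        have h1 := ht hij
        have h2 := hu hl
        rw [hu0] at h2
        have := mul_pos hμ2 (mul_pos (sub_pos.2 h1) h2)
        linarith
      · exact Filter.Eventually.of_forall fun δ _ h => absurd h hl
    · exact Filter.Eventually.of_forall fun δ h => absurd h hij
  have H₂ : ∀ i j l, ∀ᶠ δ in nhds (0 : ℝ), i < Fin.last a → j < l →
      ∀ e ∈ Set.Icc (0 : ℝ) 1 ×ˢ Set.Icc (0 : ℝ) 1,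
      0 < -μ * orient (flatPt (0, 0) μ e.1 (t i) (δ * h i))
        (flatPt (1, μ) (-μ) e.2 (u j) (δ * g j)) (flatPt (1, μ) (-μ) e.2 (u l) (δ * g l)) := by
    intro i j l
    by_cases hi : i < Fin.last a
    · by_cases hl : j < l
      · refine (eventually_forall_pos (F := fun x => -μ * orient _ _ _) (continuous_const.mul
          (continuous_orient.comp ((cont₁ i).prodMk ((cont₂ j).prodMk (cont₂ l)))))
          fun e => ?_).mono fun δ hδ _ _ => hδ
        simp only [zero_mul, flatPt_zero, orient]
        have h1 := ht hi
        have h2 := hu hl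
        rw [ht1] at h1
        have := mul_pos hμ2 (mul_pos (sub_pos.2 h1) (sub_pos.2 h2))
        linarith
      · exact Filter.Eventually.of_forall fun δ _ h => absurd h hl
    · exact Filter.Eventually.of_forall fun δ h => absurd h hi
  simp only [← Filter.eventually_all] at H₁ H₂
  filter_upwards [H₁, H₂] with δ h1 h2 e he
  exact ⟨fun i j l hij hl => h1 i j l hij hl e he, fun i j l hi hl => h2 i j l hi hl e he⟩

theorem eventually_strictMono {k : ℕ} {t : Fin (k + 1) → ℝ} (ht : StrictMono t) (c : ℝ) (hc : 0 < c)
    (h : Fin (k + 1) → ℝ) :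
    ∀ᶠ δ in nhds (0 : ℝ), StrictMono fun i => c * t i + δ * h i := by
  have H : ∀ i j, ∀ᶠ δ in nhds (0 : ℝ), i < j → c * t i + δ * h i < c * t j + δ * h j := by
    intro i j
    by_cases hij : i < j
    · have h1 : Continuous fun δ : ℝ => c * t i + δ * h i := by fun_prop
      have h2 : Continuous fun δ : ℝ => c * t j + δ * h j := by fun_prop
      refine (h1.continuousAt.eventually_lt h2.continuousAt ?_).mono fun δ hδ _ => hδ
      simpa using mul_lt_mul_of_pos_left (ht hij) hc
    · exact Filter.Eventually.of_forall fun δ h => absurd h hij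
  simp only [← Filter.eventually_all] at H
  filter_upwards [H] with δ hδ i j hij
  exact hδ i j hij

/-- Orientations within a flattened piece do not depend on the positive factor. -/
theorem ccw_flatPt {p : ℝ × ℝ} {m ε : ℝ} (hε : 0 < ε) (t c t' c' t'' c'' : ℝ) :
    Ccw (flatPt p m ε t c) (flatPt p m ε t' c') (flatPt p m ε t'' c'') ↔
      Ccw (flatPt p m 1 t c) (flatPt p m 1 t' c') (flatPt p m 1 t'' c'') := by
  rw [ccw_iff, ccw_iff, orient_flatPt]
  exact mul_pos_iff_of_pos_left hε

theorem strictMono_dot_flatPt {k : ℕ} {p q : ℝ × ℝ} {m δ : ℝ} {t h : Fin (k + 1) → ℝ}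
    (H : StrictMono fun i => (1 + m ^ 2) * t i + δ * (m * h i)) (hq : q = (p.1 + 1, p.2 + m)) :
    StrictMono fun i => dot (flatPt p m 1 (t i) (δ * h i) - p) (q - p) := by
  intro i j hij
  have := H hij
  simp only [hq, flatPt_one, dot, Prod.fst_sub, Prod.snd_sub] at this ⊢
  linarith

namespace NearEdge

theorem orient_ne_zero (C : NearEdge) (i j k : Fin (C.n + 1)) (hij : i < j) (hjk : j < k) :
    orient (C.pt i) (C.pt j) (C.pt k) ≠ 0 := by
  rw [← node_val, ← node_val, ← node_val]
  exact orient_node_ne_zero hij hjk (by omega)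

/-- One `δ` is chosen so small that mixed orientations are right for all pairs of shrinking factors
in the unit square and projections stay ordered. All shrunken joins are then in general position
with the same order type. -/
theorem exists_isGluedSum {μ : ℝ} (hμ : μ ≠ 0) (A B : NearEdge) (hA : 0 < A.n) (hB : 0 < B.n) :
    ∃ C, IsGluedSum (1, μ) A B C := by
  obtain ⟨t, h, ht, ht0, ht1, hh0, hh1, hσ⟩ := A.exists_placement hA (0, 0) μ
  obtain ⟨u, g, hu, hu0, hu1, hg0, hg1, hτ⟩ := B.exists_placement hB (1, μ) (-μ)
  obtain ⟨δ, ⟨hmix, hmA, hmB⟩, hδ⟩ :=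
    ((((eventually_mixed (h := h) (g := g) hμ ht ht1 hu hu0).and
      ((eventually_strictMono ht (1 + μ ^ 2) (by positivity) fun i => μ * h i).and
        (eventually_strictMono hu (1 + (-μ) ^ 2) (by positivity) fun i => -μ * g i))).filter_mono
          (nhdsWithin_le_nhds (s := Set.Ioi 0))).and self_mem_nhdsWithin).exists
  obtain ⟨σ, hσd, hσ⟩ := hσ δ hδ
  obtain ⟨τ, hτd, hτ⟩ := hτ δ hδ
  set α : ℝ → Fin (A.n + 1) → ℝ × ℝ := fun ε i => flatPt (0, 0) μ ε (t i) (δ * h i) with hα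
  set β : ℝ → Fin (B.n + 1) → ℝ × ℝ := fun ε j => flatPt (1, μ) (-μ) ε (u j) (δ * g j) with hβ
  have hα0 : ∀ ε, α ε 0 = (0, 0) := fun ε => by
    simp only [hα, ht0, hh0, mul_zero, flatPt_zero, add_zero]
  have hα1 : ∀ ε, α ε (Fin.last A.n) = (1, μ) := fun ε => by
    simp only [hα, ht1, hh1, mul_zero, flatPt_zero, zero_add, mul_one]
  have hβ0 : ∀ ε, β ε 0 = (1, μ) := fun ε => by
    simp only [hβ, hu0, hg0, mul_zero, flatPt_zero, add_zero]
  have hβ1 : ∀ ε, β ε (Fin.last B.n) = (2, 0) := fun ε => by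
    simp only [hβ, hu1, hg1, mul_zero, flatPt_zero, mul_one]
    norm_num
  have hglue : ∀ ε ε', α ε (Fin.last A.n) = β ε' 0 := fun ε ε' => by rw [hα1, hβ0]
  have hjoin : ∀ ε ε', 0 < ε → ε ≤ 1 → 0 < ε' → ε' ≤ 1 → IsJoinable (-μ) (α ε) (β ε') := by
    intro ε ε' h0 h1 h0' h1'
    obtain ⟨m1, m2⟩ := hmix (ε, ε') ⟨⟨h0.le, h1⟩, ⟨h0'.le, h1'⟩⟩
    refine ⟨hglue ε ε', fun i j k hij hjk => ?_, fun i j k hij hjk => ?_, m1, m2⟩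
    · simp only [hα]
      rw [orient_flatPt, ← hσ, ← hσ, ← hσ, orient_map]
      exact mul_ne_zero h0.ne' (mul_ne_zero hσd.ne' (A.orient_ne_zero i j k hij hjk))
    · simp only [hβ]
      rw [orient_flatPt, ← hτ, ← hτ, ← hτ, orient_map]
      exact mul_ne_zero h0'.ne' (mul_ne_zero hτd.ne' (B.orient_ne_zero i j k hij hjk))
  have hsame : ∀ ε ε', 0 < ε → ε ≤ 1 → 0 < ε' → ε' ≤ 1 →
      SameOrderType (joinPts (α 1) (β 1)) (joinPts (α ε) (β ε')) := by
    intro ε ε' h0 h1 h0' h1'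
    exact (hjoin 1 1 one_pos le_rfl one_pos le_rfl).sameOrderType (hjoin ε ε' h0 h1 h0' h1')
      (fun i j k => (ccw_flatPt h0 _ _ _ _ _ _).symm)
      (fun i j k => (ccw_flatPt h0' _ _ _ _ _ _).symm)
  have hσα : (fun i => σ (A.pt i)) = α 1 := funext hσ
  have hτβ : (fun j => τ (B.pt j)) = β 1 := funext hτ
  have hJ := hjoin 1 1 one_pos le_rfl one_pos le_rfl
  have hmono : StrictMono fun i => (joinPts (α 1) (β 1) i).1 := by
    have hfst : ∀ i, (α 1 i).1 = t i := fun i => by simp only [hα, flatPt_one, zero_add]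
    have hfst' : ∀ j, (β 1 j).1 = 1 + u j := fun j => by simp only [hβ, flatPt_one]
    intro i j hij
    have hij' := Fin.lt_def.1 hij
    simp only
    rcases le_or_gt (j : ℕ) A.n with hj | hj
    · rw [joinPts_of_le _ _ hj, joinPts_of_le _ _ (by omega), hfst, hfst]
      exact ht (Fin.mk_lt_mk.2 hij)
    rcases le_or_gt A.n (i : ℕ) with hi | hi
    · rw [joinPts_of_ge hJ.glue hi, joinPts_of_ge hJ.glue hj.le, hfst', hfst']
      exact add_lt_add_right (hu (Fin.mk_lt_mk.2 (by omega))) 1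
    · rw [joinPts_of_le _ _ hi.le, joinPts_of_ge hJ.glue hj.le, hfst, hfst']
      have h1 := ht (show (⟨i, by omega⟩ : Fin (A.n + 1)) < Fin.last A.n from Fin.lt_def.2 hi)
      have h2 := hu (show (0 : Fin (B.n + 1)) < ⟨j - A.n, by omega⟩ from
        Fin.lt_def.2 (by simp only [Fin.val_zero]; omega))
      rw [ht1] at h1
      rw [hu0] at h2
      linarith
  refine ⟨⟨A.n + B.n, joinPts (α 1) (β 1), hmono, fun i j k hij hjk hc =>
    hJ.general i j k hij hjk (orient_eq_zero_of_collinear hc)⟩, σ, τ, hσd, hτd, ?_, ?_, ?_, ?_, ?_,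
    ?_, rfl, fun i => ?_, fun j => ?_⟩
  · rw [hσ]
    exact hα0 1
  · rw [hσ]
    exact hα1 1
  · rw [hτ]
    exact hβ0 1
  · rw [hτ]
    exact hβ1 1
  · rw [hσα, show (fun j : Fin B.n => τ (B.pt j.succ)) = fun j : Fin B.n => β 1 j.succ from
      funext fun j => hτ j.succ]
    refine ⟨hA, ?_, fun ε h0 h1 => ?_⟩
    · rw [hα0, hα1]
      exact strictMono_dot_flatPt hmA (by simp)
    · have hs : (fun i => shrink ε (α 1 0) (α 1 (Fin.last A.n)) (α 1 i)) = α ε := by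
        funext i
        rw [hα0, hα1]
        simpa using shrink_flatPt (0, 0) μ ε (t i) (δ * h i)
      rw [hs, sumElim_left_eq (hglue 1 1), sumElim_left_eq (hglue ε 1)]
      exact (hsame ε 1 h0 h1 one_pos le_rfl).comp _
  · rw [hτβ, show (fun i : Fin A.n => σ (A.pt i.castSucc)) = fun i : Fin A.n => α 1 i.castSucc from
      funext fun i => hσ i.castSucc]
    refine ⟨hB, ?_, fun ε h0 h1 => ?_⟩
    · rw [hβ0, hβ1]
      exact strictMono_dot_flatPt hmB (by norm_num)
    · have hs : (fun j => shrink ε (β 1 0) (β 1 (Fin.last B.n)) (β 1 j)) = β ε := by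
        funext j
        rw [hβ0, hβ1]
        have := shrink_flatPt (1, μ) (-μ) ε (u j) (δ * g j)
        norm_num at this
        exact this
      rw [hs, sumElim_right_eq (hglue 1 1), sumElim_right_eq (hglue 1 ε)]
      exact (hsame 1 ε one_pos le_rfl h0 h1).comp _
  · rw [hσ]
    exact joinPts_of_le (α 1) (β 1) (k := ⟨i, by omega⟩) (Nat.lt_succ_iff.1 i.2)
  · rw [hτ]
    simp only
    rw [joinPts_of_ge hJ.glue (k := ⟨A.n + j, by omega⟩) (Nat.le_add_right _ _)]
    simp [hβ]

theorem exists_isSum {μ : ℝ} (hμ : μ ≠ 0) (A B : NearEdge) : ∃ C, IsSum (1, μ) A B C := by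
  rcases Nat.eq_zero_or_pos A.n with hA | hA
  · exact ⟨B, Or.inl ⟨hA, Equiv.refl B⟩⟩
  rcases Nat.eq_zero_or_pos B.n with hB | hB
  · exact ⟨A, Or.inr (Or.inl ⟨hB, Equiv.refl A⟩)⟩
  · obtain ⟨C, hC⟩ := exists_isGluedSum hμ A B hA hB
    exact ⟨C, Or.inr (Or.inr hC)⟩

end NearEdge

theorem mainTheorem4 :
    -- the concave sum makes chains (up to order type) a monoid, and `t` is a homomorphism
    (∃ (_ : Monoid ChainType) (φ : ChainType →* ℚ[X]),
      (∀ A B : Chain, ∃ C : NearEdge,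
        NearEdge.IsConcaveSum A.toNearEdge B.toNearEdge C) ∧
      (∀ (A B : Chain) (C : NearEdge), NearEdge.IsConcaveSum A.toNearEdge B.toNearEdge C →
        ∃ hC : C.IsChain, A.type * B.type = Chain.type ⟨C, hC⟩) ∧
      (∀ C : Chain, C.n = 0 → C.type = 1) ∧
      (∀ C : Chain, φ C.type = C.t)) ∧
    -- the convex sum makes chains (up to order type) a monoid, and `m` is a homomorphism
    (∃ (_ : Monoid ChainType) (φ : ChainType →* ℚ[X]),
      (∀ A B : Chain, ∃ C : NearEdge,
        NearEdge.IsConvexSum A.toNearEdge B.toNearEdge C) ∧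
      (∀ (A B : Chain) (C : NearEdge), NearEdge.IsConvexSum A.toNearEdge B.toNearEdge C →
        ∃ hC : C.IsChain, A.type * B.type = Chain.type ⟨C, hC⟩) ∧
      (∀ C : Chain, C.n = 0 → C.type = 1) ∧
      (∀ C : Chain, φ C.type = C.m)) := by
  constructor
  -- For the apex `(1, μ)` mixed triples are counterclockwise exactly when `μ < 0`: never in the
  -- concave case, always in the convex one.
  · refine Chain.exists_monoidHom (s := (1 : ℝ) < 0) (fun A B C h => h.isOrderSum one_ne_zero)
      (NearEdge.exists_isSum one_ne_zero) (fun C hC => ?_) fun A B C h => ?_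
    · rw [Chain.t_eq, Chain.dissectionPoly_of_n_eq_zero hC]
    · rw [Chain.t_eq, Chain.t_eq, Chain.t_eq]
      rw [show ((1 : ℝ) < 0) = False by norm_num] at h
      exact h.dissectionPoly_eq
  · have h₁ : (-1 : ℝ) ≠ 0 := by norm_num
    refine Chain.exists_monoidHom (s := (-1 : ℝ) < 0) (fun A B C h => h.isOrderSum h₁)
      (NearEdge.exists_isSum h₁) (fun C hC => ?_) fun A B C h => ?_
    · rw [Chain.m, Chain.t_eq, Chain.dissectionPoly_of_n_eq_zero hC]
      simpa [domino] using mapM_X_pow 0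
    · rw [Chain.m, Chain.m, Chain.m, Chain.t_eq, Chain.t_eq, Chain.t_eq]
      rw [show ((-1 : ℝ) < 0) = True by norm_num] at h
      exact h.mapM_dissectionPoly_eq
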